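/- Let $\mathcal M(\mathbb R^n)$ be the set of positive Borel measures on $\mathbb R^n$ with finite mass and bounded support, and write $|\mu|=\mu(\mathbb R^n)$ for the mass of $\mu$ (and $|\sigma|=|\sigma^+|+|\sigma^-|$ for the total variation of a signed measure $\sigma$). For $\mu,\nu\in\mathcal M(\mathbb R^n)$ with $|\mu|=|\nu|$ let $W(\mu,\nu)=\inf_\pi\int|x-y|\,d\pi(x,y)$ be the Wasserstein distance, the infimum being over all measures $\pi$ on $\mathbb R^n\times\mathbb R^n$ with marginals $\mu$ and $\nu$. For arbitrary $\mu,\nu\in\mathcal M(\mathbb R^n)$ define the generalized Wasserstein distance $$W^g(\mu,\nu)=\inf\big\{|\mu-\tilde\mu|+|\nu-\tilde\nu|+W(\tilde\mu,\tilde\nu)\;:\;\tilde\mu,\tilde\nu\in\mathcal M(\mathbb R^n),\ |\tilde\mu|=|\tilde\nu|\big\}.$$ Fix $T>0$, and let $s:\mathcal M(\mathbb R^n)\to\mathcal M(\mathbb R^n)$ satisfy (s1) there is $L\ge 0$ such that $W^g(s[\mu],s[\nu])\le L\,W^g(\mu,\nu)$ for all $\mu,\nu\in\mathcal M(\mathbb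 R^n)$; (s2) there is $R$ such that $\operatorname{supp}(s[\mu])\subset B(0,R)$ for all $\mu\in\mathcal M(\mathbb R^n)$. A solution of the Cauchy problem $$\dot\mu=s[\mu],\qquad \mu(0)=\mu_0 \tag{1}$$ is a curve $\mu:[0,T]\to\mathcal M(\mathbb R^n)$, continuous with respect to $W^g$, with $\mu(0)=\mu_0$ and such that, for every $f\in C_c^\infty(\mathbb R^n)$, the map $t\mapsto\int f\,ds[\mu(t)]$ belongs to $L^1([0,T])$, the map $t\mapsto\int f\,d\mu(t)$ is absolutely continuous on $[0,T]$, and $\frac{d}{dt}\int f\,d\mu(t)=\int f\,ds[\mu(t)]$ for almost every $t\in[0,T]$. For an integer $N\ge1$ let $\Delta_N=1/N$, let $x_i$ be the points of $(\mathbb Z^n/N^2)\cap[-N,N]^n$, and set $\mathcal A^x_N(\mu)=\sum_i\mu\big(x_i+[0,N^{-2})^n\big)\,\delta_{x_i}$. Given $\mu_0$, the Lattice Approximate Solution $\mu^N$ is defined by $\mu^N(0)=\mathcal A^x_N(\mu_0)$, $$\mu^N((k+1)\Delta_N)=\mu^N(k\Delta_N)+\Delta_N\,\mathcal A^x_N\big(s[\mu^N(k\Delta_N)]\big),\qquad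 k=0,1,2,\dots,$$ and $\mu^N(k\Delta_N+t)=\mu^N(k\Delta_N)+t\,\mathcal A^x_N\big(s[\mu^N(k\Delta_N)]\big)$ for $t\in[0,\Delta_N]$. Then: 1. For every $\mu_0\in\mathcal M(\mathbb R^n)$ there exists a unique solution $\mu$ of (1) on $[0,T]$. 2. This solution is the uniform-in-time limit of the Lattice Approximate Solutions: $\sup_{t\in[0,T]}W^g(\mu^N(t),\mu(t))\to0$ as $N\to\infty$. 3. If $\mu$ and $\nu$ are solutions of (1) with initial data $\mu_0$ and $\nu_0$ respectively, then $W^g(\mu(t),\nu(t))\le e^{Lt}\,W^g(\mu_0,\nu_0)$ for all $t\in[0,T]$. -/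

import Mathlib

open MeasureTheory Set Filter Topology
open scoped NNReal ENNReal ContDiff

noncomputable section

namespace MeasureSource

/-- The Euclidean space `ℝⁿ`. -/
abbrev E (n : ℕ) : Type := EuclideanSpace ℝ (Fin n)

/-- The space `𝓜(ℝⁿ)` of positive Borel measures on `ℝⁿ` with finite mass and bounded support
(such measures are automatically regular). -/
@[ext]
structure M (n : ℕ) where
  toMeasure : Measure (E n)
  finite : IsFiniteMeasure toMeasure
  bounded : Bornology.IsBounded toMeasure.support

namespace M

variable {n : ℕ}

instance (μ : M n) : IsFiniteMeasure μ.toMeasure := μ.finite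

theorem support_smul_subset (c : ℝ≥0∞) (μ : Measure (E n)) : (c • μ).support ⊆ μ.support :=
  Measure.AbsolutelyContinuous.support_mono Measure.smul_absolutelyContinuous

theorem support_sum_dirac_bounded {ι : Type*} (S : Finset ι) (c : ι → ℝ≥0∞) (x : ι → E n) :
    Bornology.IsBounded (∑ i ∈ S, c i • Measure.dirac (x i)).support := by
  classical
  induction S using Finset.induction_on with
  | empty => simp
  | insert a S ha ih =>
    rw [Finset.sum_insert ha, Measure.support_add]
    refine Bornology.IsBounded.union (Bornology.IsBounded.subset ?_ (support_smul_subset _ _)) ih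
    refine (Bornology.isBounded_singleton (x := x a)).subset ?_
    exact Measure.support_subset_of_isClosed isClosed_singleton
      ((mem_ae_dirac_iff (measurableSet_singleton _)).2 rfl)

instance : Zero (M n) := ⟨⟨0, inferInstance, by simp⟩⟩

instance : Add (M n) :=
  ⟨fun μ ν => ⟨μ.toMeasure + ν.toMeasure, inferInstance, by
    rw [Measure.support_add]; exact μ.bounded.union ν.bounded⟩⟩

instance : SMul ℝ≥0 (M n) :=
  ⟨fun c μ => ⟨(c : ℝ≥0∞) • μ.toMeasure, Measure.smul_finite _ ENNReal.coe_ne_top,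
    μ.bounded.subset (support_smul_subset _ _)⟩⟩

/-- The mass `|μ| = μ(ℝⁿ)`. -/
def mass (μ : M n) : ℝ≥0∞ := μ.toMeasure univ

end M

variable {n : ℕ}

/-- The `L¹` distance `|μ - ν|`: the total variation norm `|σ⁺| + |σ⁻|` of the signed measure
`σ = μ - ν`. -/
def tvDist (μ ν : M n) : ℝ≥0∞ :=
  (μ.toMeasure.toSignedMeasure - ν.toMeasure.toSignedMeasure).totalVariation univ

/-- The transference plans from `μ` to `ν`, not normalized: measures on `ℝⁿ × ℝⁿ` with marginals
`μ` and `ν` (that is, `|μ|` times a probability plan). -/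
def Plans (μ ν : M n) : Set (Measure (E n × E n)) :=
  {π | π.map Prod.fst = μ.toMeasure ∧ π.map Prod.snd = ν.toMeasure}

/-- The Wasserstein distance with exponent `p = 1` between measures of the same mass
(it is `∞` when the masses differ). -/
def W (μ ν : M n) : ℝ≥0∞ :=
  ⨅ π ∈ Plans μ ν, ∫⁻ z, edist z.1 z.2 ∂π

/-- The generalized Wasserstein distance with `a = b = p = 1`: the infimum of
`|μ - μ'| + |ν - ν'| + W(μ', ν')` over all `μ', ν'` of equal mass. -/
def Wg (μ ν : M n) : ℝ≥0∞ :=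
  ⨅ (μ' : M n) (ν' : M n) (_ : μ'.mass = ν'.mass), tvDist μ μ' + tvDist ν ν' + W μ' ν'

/-- `μ : [0,T] → 𝓜(ℝⁿ)` is a solution of `dμ/dt = s[μ]`, `μ(0) = μ₀`: a curve, continuous for
`Wg`, that solves the equation weakly against every test function `f ∈ C_c^∞(ℝⁿ)`.
Only the values of `μ` on `[0,T]` matter. -/
structure IsSolution (s : M n → M n) (T : ℝ) (μ₀ : M n) (μ : ℝ → M n) : Prop where
  initial : μ 0 = μ₀
  continuous : ∀ t ∈ Icc 0 T, Tendsto (fun τ => Wg (μ τ) (μ t)) (𝓝[Icc 0 T] t) (𝓝 0)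
  integrable : ∀ f : E n → ℝ, ContDiff ℝ ∞ f → HasCompactSupport f →
    IntegrableOn (fun τ => ∫ x, f x ∂(s (μ τ)).toMeasure) (Icc 0 T)
  absolutelyContinuous : ∀ f : E n → ℝ, ContDiff ℝ ∞ f → HasCompactSupport f →
    AbsolutelyContinuousOnInterval (fun t => ∫ x, f x ∂(μ t).toMeasure) 0 T
  hasDeriv : ∀ f : E n → ℝ, ContDiff ℝ ∞ f → HasCompactSupport f →
    ∀ᵐ t ∂volume.restrict (Icc 0 T),
      HasDerivWithinAt (fun τ => ∫ x, f x ∂(μ τ).toMeasure)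
        (∫ x, f x ∂(s (μ t)).toMeasure) (Icc 0 T) t

/-- The multi-indices `i ∈ ℤⁿ` of the lattice points `i / N²` lying in `[-N, N]ⁿ`, namely those
with `|iⱼ| ≤ N³` for all `j`. -/
def latticeIndex (n N : ℕ) : Finset (Fin n → ℤ) :=
  Fintype.piFinset fun _ => Finset.Icc (-(N : ℤ) ^ 3) ((N : ℤ) ^ 3)

/-- The lattice point `xᵢ = i / N²`. -/
def latticePoint (N : ℕ) (i : Fin n → ℤ) : E n :=
  WithLp.toLp 2 fun j => (i j : ℝ) / (N : ℝ) ^ 2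

/-- The half-open cell `xᵢ + [0, 1/N²)ⁿ`. -/
def cell (N : ℕ) (i : Fin n → ℤ) : Set (E n) :=
  {x | ∀ j, x j ∈ Ico (latticePoint N i j) (latticePoint N i j + 1 / (N : ℝ) ^ 2)}

/-- The discretization operator `A^x_N(μ) = ∑ᵢ μ(xᵢ + [0, 1/N²)ⁿ) δ_{xᵢ}` for `N ≥ 1`
(the value for `N = 0` is irrelevant). -/
def discretize (N : ℕ) (μ : M n) : M n where
  toMeasure := ∑ i ∈ latticeIndex n N, μ.toMeasure (cell N i) • Measure.dirac (latticePoint N i)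
  finite := ⟨by
    rw [Measure.finsetSum_apply]
    refine ENNReal.sum_lt_top.2 fun i _ => ?_
    simp [measure_lt_top]⟩
  bounded := M.support_sum_dirac_bounded _ _ _

/-- The values `μ^N(k Δ_N)`, `Δ_N = 1/N`, of the lattice Euler scheme. -/
def eulerStep (s : M n → M n) (μ₀ : M n) (N : ℕ) : ℕ → M n
  | 0 => discretize N μ₀
  | k + 1 => eulerStep s μ₀ N k + (1 / (N : ℝ≥0)) • discretize N (s (eulerStep s μ₀ N k))

/-- The Lattice Approximate Solution `μ^N` at times `t ≥ 0`: with `k = ⌊t / Δ_N⌋`,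
`μ^N(t) = μ^N(k Δ_N) + (t - k Δ_N) A^x_N(s[μ^N(k Δ_N)])`. -/
def latticeSolution (s : M n → M n) (μ₀ : M n) (N : ℕ) (t : ℝ) : M n :=
  eulerStep s μ₀ N ⌊t * N⌋₊ +
    (t - ⌊t * N⌋₊ / N).toNNReal • discretize N (s (eulerStep s μ₀ N ⌊t * N⌋₊))

end MeasureSource

end

noncomputable section

namespace MeasureSource

variable {n : ℕ}

/-! The generalized Wasserstein distance is a dual norm: `Wg μ ν` is the supremum of `∫ f dμ - ∫ f
dν` over `1`-Lipschitz `f` with `|f| ≤ 1`. Hence `flat`, which sends `μ` to the function `f ↦ ∫ f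
dμ`, embeds the measures isometrically in a Banach space (`edist_flat`), and the measure equation
becomes an ordinary differential equation there, with a field that is `L`-Lipschitz on the range of
the embedding.

Weak duality is a direct estimate. For the converse, both measures are cut into small cells;
Hahn–Banach gives duality for the resulting finite partial transport problem
(`exists_dual_of_transportCost`), and the discrete potentials extend to one test function
(`exists_testFun_Wg_le`).

The lattice curves are approximate trajectories of this field, so Grönwall's inequality makes them
uniformly Cauchy. Their supports lie in one ball, so weak compactness keeps the limit among the
measures (`exists_tendsto_flat`), and the limit satisfies the integral equation. Conversely, every
weak solution stays in a fixed ball and satisfies that same equation in the Banach space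
(`IsSolution.flat_eq_integral`); Grönwall then yields stability, and with it uniqueness. -/

/-! ### Total variation through identities between positive measures. -/

theorem tvDist_le_of_add_eq {μ ν : M n} {γ δ : Measure (E n)} [IsFiniteMeasure γ]
    [IsFiniteMeasure δ] (h : μ.toMeasure + δ = ν.toMeasure + γ) :
    tvDist μ ν ≤ γ univ + δ univ := by
  obtain ⟨i, hi, hi₂, hi₃, hp, hm⟩ := SignedMeasure.toJordanDecomposition_spec
    (μ.toMeasure.toSignedMeasure - ν.toMeasure.toSignedMeasure)
  have hreal : ∀ A, MeasurableSet A →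
      (μ.toMeasure.toSignedMeasure - ν.toMeasure.toSignedMeasure) A = γ.real A - δ.real A := by
    intro A hA
    have h1 : (μ.toMeasure + δ).real A = (ν.toMeasure + γ).real A := by rw [h]
    rw [measureReal_add_apply, measureReal_add_apply] at h1
    rw [Measure.toSignedMeasure_sub_apply hA]
    linarith
  rw [tvDist, SignedMeasure.totalVariation, Measure.add_apply, hp, hm]
  -- The Jordan parts of `γ - δ` are, up to sign, its restrictions to a Hahn set and to the
  -- complement, so `γ` and `δ` bound their masses.
  refine add_le_add ?_ ?_
  · rw [← ENNReal.ofReal_toReal (measure_ne_top _ univ), ← ENNReal.ofReal_toReal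
      (measure_ne_top γ univ)]
    refine ENNReal.ofReal_le_ofReal ?_
    change Measure.real _ _ ≤ γ.real univ
    rw [SignedMeasure.toMeasureOfZeroLE_real_apply _ hi₂ hi MeasurableSet.univ,
      hreal _ (hi.inter MeasurableSet.univ)]
    have := measureReal_mono (μ := γ) (subset_univ (i ∩ univ))
    have := measureReal_nonneg (μ := δ) (s := i ∩ univ)
    linarith
  · rw [← ENNReal.ofReal_toReal (measure_ne_top _ univ), ← ENNReal.ofReal_toReal
      (measure_ne_top δ univ)]
    refine ENNReal.ofReal_le_ofReal ?_
    change Measure.real _ _ ≤ δ.real univ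
    rw [SignedMeasure.toMeasureOfLEZero_real_apply _ hi₃ hi.compl MeasurableSet.univ,
      hreal _ (hi.compl.inter MeasurableSet.univ)]
    have := measureReal_mono (μ := δ) (subset_univ (iᶜ ∩ univ))
    have := measureReal_nonneg (μ := γ) (s := iᶜ ∩ univ)
    linarith

theorem exists_add_eq_tvDist (μ ν : M n) : ∃ γ δ : Measure (E n), IsFiniteMeasure γ ∧
    IsFiniteMeasure δ ∧ μ.toMeasure + δ = ν.toMeasure + γ ∧ tvDist μ ν = γ univ + δ univ := by
  set σ := μ.toMeasure.toSignedMeasure - ν.toMeasure.toSignedMeasure with hσ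
  refine ⟨σ.toJordanDecomposition.posPart, σ.toJordanDecomposition.negPart, inferInstance,
    inferInstance, ?_, rfl⟩
  ext A hA
  have h1 := σ.apply_eq_posPart_real_sub_negPart_real hA
  rw [hσ, Measure.toSignedMeasure_sub_apply hA, ← hσ] at h1
  rw [← measureReal_eq_measureReal_iff, measureReal_add_apply, measureReal_add_apply]
  linarith

/-! ### Test functions and weak duality. -/

/-- The test functions of the flat metric: `1`-Lipschitz functions bounded by `1`. -/
structure TestFun (n : ℕ) where
  toFun : E n → ℝ
  lipschitz : LipschitzWith 1 toFun
  abs_le_one : ∀ x, |toFun x| ≤ 1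

/-- With the discrete topology, bounded continuous functions on `TestFun n` are all bounded
functions, under the supremum norm. -/
instance : TopologicalSpace (TestFun n) := ⊥

instance : DiscreteTopology (TestFun n) := ⟨rfl⟩

instance : CoeFun (TestFun n) fun _ => E n → ℝ := ⟨TestFun.toFun⟩

namespace TestFun

theorem continuous (f : TestFun n) : Continuous f := f.lipschitz.continuous

theorem integrable (f : TestFun n) (μ : Measure (E n)) [IsFiniteMeasure μ] :
    Integrable f μ :=
  Integrable.of_bound f.continuous.aestronglyMeasurable 1 (ae_of_all _ f.abs_le_one)

theorem abs_integral_le (f : TestFun n) (μ : Measure (E n)) [IsFiniteMeasure μ] :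
    |∫ x, f x ∂μ| ≤ μ.real univ := by
  simpa using norm_integral_le_of_norm_le_const (μ := μ) (f := f) (C := 1)
    (ae_of_all _ f.abs_le_one)

theorem sub_le_dist (f : TestFun n) (x y : E n) : f x - f y ≤ dist x y := by
  have := f.lipschitz.dist_le_mul x y
  rw [Real.dist_eq] at this
  simpa using (le_abs_self _).trans this

/-- The constant test function `1`. -/
def one : TestFun n := ⟨fun _ => 1, LipschitzWith.const' 1, by simp⟩

/-- The opposite of a test function. -/
def neg (f : TestFun n) : TestFun n :=
  ⟨fun x => -f x, f.lipschitz.neg, fun x => by simpa using f.abs_le_one x⟩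

end TestFun

theorem integral_sub_integral_le_tvDist (f : TestFun n) (μ ν : M n) :
    |∫ x, f x ∂μ.toMeasure - ∫ x, f x ∂ν.toMeasure| ≤ (tvDist μ ν).toReal := by
  obtain ⟨γ, δ, _, _, h, h'⟩ := exists_add_eq_tvDist μ ν
  have h1 : ∫ x, f x ∂(μ.toMeasure + δ) = ∫ x, f x ∂(ν.toMeasure + γ) := by rw [h]
  rw [integral_add_measure (f.integrable _) (f.integrable _),
    integral_add_measure (f.integrable _) (f.integrable _)] at h1
  rw [h', ENNReal.toReal_add (measure_ne_top _ _) (measure_ne_top _ _)]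
  have h2 := abs_le.1 (f.abs_integral_le γ)
  have h3 := abs_le.1 (f.abs_integral_le δ)
  simp only [measureReal_def] at h2 h3
  rw [abs_le]
  constructor <;> linarith [h2.1, h2.2, h3.1, h3.2]

theorem tvDist_ne_top (μ ν : M n) : tvDist μ ν ≠ ⊤ := measure_ne_top _ _

theorem integral_sub_integral_le_lintegral_of_mem_plans (f : TestFun n) {μ ν : M n}
    {π : Measure (E n × E n)} (hπ : π ∈ Plans μ ν) :
    ENNReal.ofReal (∫ x, f x ∂μ.toMeasure - ∫ x, f x ∂ν.toMeasure) ≤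
      ∫⁻ z, edist z.1 z.2 ∂π := by
  obtain ⟨h1, h2⟩ := hπ
  have : IsFiniteMeasure π := ⟨by
    have := measure_lt_top μ.toMeasure univ
    rwa [← h1, Measure.map_apply measurable_fst MeasurableSet.univ, preimage_univ] at this⟩
  by_cases hfin : ∫⁻ z, edist z.1 z.2 ∂π = ⊤
  · rw [hfin]; exact le_top
  have hint : Integrable (fun z : E n × E n => dist z.1 z.2) π := by
    refine ⟨by fun_prop, ?_⟩
    rw [hasFiniteIntegral_iff_ofReal (ae_of_all _ fun z => dist_nonneg)]
    simpa [← edist_dist] using lt_top_iff_ne_top.2 hfin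
  have hf1 : Integrable (fun z : E n × E n => f z.1) π :=
    Integrable.of_bound (f.continuous.comp continuous_fst).aestronglyMeasurable 1
      (ae_of_all _ fun z => f.abs_le_one _)
  have hf2 : Integrable (fun z : E n × E n => f z.2) π :=
    Integrable.of_bound (f.continuous.comp continuous_snd).aestronglyMeasurable 1
      (ae_of_all _ fun z => f.abs_le_one _)
  rw [← h1, ← h2, integral_map measurable_fst.aemeasurable f.continuous.aestronglyMeasurable,
    integral_map measurable_snd.aemeasurable f.continuous.aestronglyMeasurable,
    ← integral_sub hf1 hf2]
  refine (ENNReal.ofReal_le_ofReal (integral_mono (hf1.sub hf2) hint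
    fun z => f.sub_le_dist _ _)).trans ?_
  rw [ofReal_integral_eq_lintegral_ofReal hint (ae_of_all _ fun z => dist_nonneg)]
  simp [← edist_dist]

/-- The bound `|f| ≤ 1` pays for the two total variation terms and the Lipschitz bound for the
transport term. -/
theorem ofReal_integral_sub_integral_le_Wg (f : TestFun n) (μ ν : M n) :
    ENNReal.ofReal (∫ x, f x ∂μ.toMeasure - ∫ x, f x ∂ν.toMeasure) ≤ Wg μ ν := by
  refine le_iInf fun μ' => le_iInf fun ν' => le_iInf fun _ => ?_
  have hW : ENNReal.ofReal (∫ x, f x ∂μ'.toMeasure - ∫ x, f x ∂ν'.toMeasure) ≤ W μ' ν' :=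
    le_iInf₂ fun π hπ => integral_sub_integral_le_lintegral_of_mem_plans f hπ
  have h1 := abs_le.1 (integral_sub_integral_le_tvDist f μ μ')
  have h2 := abs_le.1 (integral_sub_integral_le_tvDist f ν ν')
  calc _ ≤ ENNReal.ofReal ((tvDist μ μ').toReal + (tvDist ν ν').toReal +
        (∫ x, f x ∂μ'.toMeasure - ∫ x, f x ∂ν'.toMeasure)) := by
        apply ENNReal.ofReal_le_ofReal; linarith [h1.2, h2.1]
    _ ≤ ENNReal.ofReal ((tvDist μ μ').toReal + (tvDist ν ν').toReal) +
        ENNReal.ofReal (∫ x, f x ∂μ'.toMeasure - ∫ x, f x ∂ν'.toMeasure) :=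
        ENNReal.ofReal_add_le
    _ ≤ _ := by
        rw [ENNReal.ofReal_add ENNReal.toReal_nonneg ENNReal.toReal_nonneg,
          ENNReal.ofReal_toReal (tvDist_ne_top _ _), ENNReal.ofReal_toReal (tvDist_ne_top _ _)]
        gcongr

/-! ### Duality for partial transport between finitely many points. -/

/-- The cost of the partial transport `P` between the weights `u` and `v`. -/
def transportCost {ι : Type*} [Fintype ι] (D : ι → ι → ℝ) (u v : ι → ℝ) (P : ι → ι → ℝ≥0) : ℝ :=
  ∑ i, |u i - ∑ j, (P i j : ℝ)| + ∑ j, |v j - ∑ i, (P i j : ℝ)| + ∑ i, ∑ j, (P i j : ℝ) * D i j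

section Finite

variable {ι : Type*} [Fintype ι] {D : ι → ι → ℝ}

theorem transportCost_nonneg (hD : ∀ i j, 0 ≤ D i j) (u v : ι → ℝ) (P : ι → ι → ℝ≥0) :
    0 ≤ transportCost D u v P := by
  have : 0 ≤ ∑ i, ∑ j, (P i j : ℝ) * D i j :=
    Finset.sum_nonneg fun i _ => Finset.sum_nonneg fun j _ => mul_nonneg (P i j).2 (hD i j)
  unfold transportCost
  positivity

theorem transportCost_add_le (u v u' v' : ι → ℝ) (P P' : ι → ι → ℝ≥0) :
    transportCost D (u + u') (v + v') (P + P') ≤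
      transportCost D u v P + transportCost D u' v' P' := by
  have key : ∀ a b c d : ℝ, |a + b - (c + d)| ≤ |a - c| + |b - d| := fun a b c d => by
    rw [add_sub_add_comm]; exact abs_add_le _ _
  have h1 := Finset.sum_le_sum fun i (_ : i ∈ Finset.univ) =>
    key (u i) (u' i) (∑ j, (P i j : ℝ)) (∑ j, (P' i j : ℝ))
  have h2 := Finset.sum_le_sum fun j (_ : j ∈ Finset.univ) =>
    key (v j) (v' j) (∑ i, (P i j : ℝ)) (∑ i, (P' i j : ℝ))
  simp only [transportCost, Pi.add_apply, NNReal.coe_add, add_mul, Finset.sum_add_distrib] at *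
  linarith

theorem transportCost_smul (c : ℝ≥0) (u v : ι → ℝ) (P : ι → ι → ℝ≥0) :
    transportCost D ((c : ℝ) • u) ((c : ℝ) • v) (c • P) = c * transportCost D u v P := by
  simp only [transportCost, Pi.smul_apply, smul_eq_mul, NNReal.coe_mul, ← Finset.mul_sum,
    ← mul_sub, abs_mul, NNReal.abs_eq, mul_assoc, mul_add]

/-- The optimal partial transport cost. -/
def optimalCost (D : ι → ι → ℝ) (w : (ι → ℝ) × (ι → ℝ)) : ℝ :=
  ⨅ P : ι → ι → ℝ≥0, transportCost D w.1 w.2 P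

theorem optimalCost_le (hD : ∀ i j, 0 ≤ D i j) (w : (ι → ℝ) × (ι → ℝ)) (P : ι → ι → ℝ≥0) :
    optimalCost D w ≤ transportCost D w.1 w.2 P :=
  ciInf_le ⟨0, by rintro _ ⟨P, rfl⟩; exact transportCost_nonneg hD _ _ P⟩ P

theorem optimalCost_nonneg (hD : ∀ i j, 0 ≤ D i j) (w : (ι → ℝ) × (ι → ℝ)) :
    0 ≤ optimalCost D w :=
  le_ciInf fun P => transportCost_nonneg hD _ _ P

theorem optimalCost_smul (c : ℝ) (hc : 0 < c) (w : (ι → ℝ) × (ι → ℝ))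
    (hD : ∀ i j, 0 ≤ D i j) : optimalCost D (c • w) = c * optimalCost D w := by
  have key : ∀ (c : ℝ) (_ : 0 < c) (w : (ι → ℝ) × (ι → ℝ)),
      optimalCost D (c • w) ≤ c * optimalCost D w := by
    intro c hc w
    rw [optimalCost, optimalCost, Real.mul_iInf_of_nonneg hc.le]
    refine le_ciInf fun P => ?_
    lift c to ℝ≥0 using hc.le
    rw [← transportCost_smul]
    exact optimalCost_le hD (c • w) (c • P)
  refine (key c hc w).antisymm ?_
  have := key c⁻¹ (inv_pos.2 hc) (c • w)
  rw [inv_smul_smul₀ hc.ne'] at this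
  calc c * optimalCost D w ≤ c * (c⁻¹ * optimalCost D (c • w)) := by gcongr
    _ = _ := by field_simp

theorem optimalCost_add_le (hD : ∀ i j, 0 ≤ D i j) (w w' : (ι → ℝ) × (ι → ℝ)) :
    optimalCost D (w + w') ≤ optimalCost D w + optimalCost D w' := by
  refine le_ciInf_add_ciInf fun P P' => ?_
  exact (optimalCost_le hD _ (P + P')).trans (transportCost_add_le _ _ _ _ _ _)

/-- The optimal cost is sublinear, so Hahn–Banach extends the functional prescribed on the line
through `w`. On negative multiples of `w` that functional is nonpositive while the cost is
nonnegative. -/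
theorem exists_linearMap_le_optimalCost (hD : ∀ i j, 0 ≤ D i j) (w : (ι → ℝ) × (ι → ℝ)) :
    ∃ g : (ι → ℝ) × (ι → ℝ) →ₗ[ℝ] ℝ, g w = optimalCost D w ∧ ∀ x, g x ≤ optimalCost D x := by
  have hhom : ∀ c : ℝ, 0 < c → ∀ x, optimalCost D (c • x) = c * optimalCost D x :=
    fun c hc x => optimalCost_smul c hc x hD
  by_cases hw : w = 0
  · obtain ⟨g, -, hg⟩ := exists_extension_of_le_sublinear (⊥ : _ →ₗ.[ℝ] ℝ) (optimalCost D) hhom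
      (optimalCost_add_le hD) (fun x => by
        have hx : (x : (ι → ℝ) × (ι → ℝ)) = 0 := (Submodule.mem_bot ℝ).1 x.2
        have : x = 0 := Subtype.ext hx
        rw [this, LinearPMap.map_zero]
        exact optimalCost_nonneg hD _)
    refine ⟨g, ?_, hg⟩
    have h0 := hhom 2 two_pos 0
    rw [smul_zero] at h0
    rw [hw, map_zero]; linarith
  · obtain ⟨g, hg, hg'⟩ := exists_extension_of_le_sublinear
      (LinearPMap.mkSpanSingleton w (optimalCost D w) hw) (optimalCost D) hhom
      (optimalCost_add_le hD) (by
        rintro ⟨x, hx⟩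
        obtain ⟨c, rfl⟩ := Submodule.mem_span_singleton.1 hx
        rw [LinearPMap.mkSpanSingleton'_apply]
        rcases lt_or_ge 0 c with hc | hc
        · exact (hhom c hc w).ge
        · exact (mul_nonpos_of_nonpos_of_nonneg hc (optimalCost_nonneg hD w)).trans
            (optimalCost_nonneg hD _))
    refine ⟨g, ?_, hg'⟩
    have := hg ⟨w, Submodule.mem_span_singleton_self w⟩
    rw [this, LinearPMap.mkSpanSingleton_apply]

/-- Linear programming duality for partial transport between finitely many points. -/
theorem exists_dual_of_transportCost (hD : ∀ i j, 0 ≤ D i j) (a b : ι → ℝ) :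
    ∃ f g : ι → ℝ, (∀ i, |f i| ≤ 1) ∧ (∀ j, |g j| ≤ 1) ∧ (∀ i j, f i + g j ≤ D i j) ∧
      ∀ η > 0, ∃ P : ι → ι → ℝ≥0,
        transportCost D a b P ≤ ∑ i, a i * f i + ∑ j, b j * g j + η := by
  classical
  obtain ⟨Λ, hΛ, hle⟩ := exists_linearMap_le_optimalCost hD (a, b)
  have hbound : ∀ u v P, Λ (u, v) ≤ transportCost D u v P := fun u v P =>
    (hle _).trans (optimalCost_le hD (u, v) P)
  -- The potentials are the values of `Λ` on unit masses. Removing or creating a unit mass costs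
  -- `1`, which bounds them by `1`; carrying one from `i` to `j` costs `D i j`, which gives the
  -- joint constraint. The slack `η` avoids proving that the infimum is attained.
  refine ⟨fun i => Λ (Pi.single i 1, 0), fun j => Λ (0, Pi.single j 1), ?_, ?_, ?_, ?_⟩
  · intro i
    have h1 := hbound (Pi.single i 1) 0 0
    have h2 := hbound (-Pi.single i 1) 0 0
    have h3 : ((-Pi.single i 1, 0) : (ι → ℝ) × (ι → ℝ)) = -(Pi.single i 1, 0) := by simp
    rw [h3, map_neg] at h2
    simp [transportCost, Pi.single_apply, apply_ite abs] at h1 h2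
    rw [abs_le]; constructor <;> linarith
  · intro i
    have h1 := hbound 0 (Pi.single i 1) 0
    have h2 := hbound 0 (-Pi.single i 1) 0
    have h3 : ((0, -Pi.single i 1) : (ι → ℝ) × (ι → ℝ)) = -(0, Pi.single i 1) := by simp
    rw [h3, map_neg] at h2
    simp [transportCost, Pi.single_apply, apply_ite abs] at h1 h2
    rw [abs_le]; constructor <;> linarith
  · intro i j
    have h1 := hbound (Pi.single i 1) (Pi.single j 1) (Pi.single i (Pi.single j 1))
    have h2 : ((Pi.single i 1, Pi.single j 1) : (ι → ℝ) × (ι → ℝ)) =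
      (Pi.single i 1, 0) + (0, Pi.single j 1) := by simp
    rw [h2, map_add] at h1
    refine h1.trans (le_of_eq ?_)
    have e : ∀ k l, ((Pi.single i (Pi.single j (1 : ℝ≥0)) : ι → ι → ℝ≥0) k l : ℝ) =
        if k = i then (if l = j then 1 else 0) else 0 := by
      intro k l
      by_cases hk : k = i
      · subst hk; by_cases hl : l = j
        · subst hl; simp
        · simp [hl]
      · simp [hk]
    simp only [transportCost, e, ite_mul, zero_mul, one_mul]
    simp [Pi.single_apply]
  · intro η hη
    obtain ⟨P, hP⟩ := exists_lt_of_ciInf_lt (lt_add_of_pos_right (optimalCost D (a, b)) hη)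
    refine ⟨P, hP.le.trans (le_of_eq ?_)⟩
    rw [← hΛ]
    congr 1
    have h1 : ((a, b) : (ι → ℝ) × (ι → ℝ)) = ∑ i, a i • ((Pi.single i 1, 0) : (ι → ℝ) × (ι → ℝ)) +
        ∑ j, b j • ((0, Pi.single j 1) : (ι → ℝ) × (ι → ℝ)) := by
      ext k
      · simp [Prod.fst_sum, Finset.sum_apply, Pi.single_apply]
      · simp [Prod.snd_sum, Finset.sum_apply, Pi.single_apply]
    rw [h1, map_add, map_sum, map_sum]
    simp only [map_smul, smul_eq_mul]

end Finite

/-! ### From finite transport problems to measures: strong duality. -/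

theorem M.exists_measure_compl_closedBall_eq_zero (μ : M n) :
    ∃ R : ℝ, μ.toMeasure (Metric.closedBall 0 R)ᶜ = 0 := by
  obtain ⟨R, hR⟩ := μ.bounded.subset_closedBall 0
  exact ⟨R, measure_mono_null (compl_subset_compl.2 hR) Measure.measure_compl_support⟩

theorem isBounded_support_of_measure_compl {μ : Measure (E n)} {c : E n} {R : ℝ}
    (h : μ (Metric.closedBall c R)ᶜ = 0) : Bornology.IsBounded μ.support :=
  Metric.isBounded_closedBall.subset (Measure.support_subset_of_isClosed Metric.isClosed_closedBall
    (mem_ae_iff.2 h))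

theorem isBounded_support_sum {ι : Type*} (S : Finset ι) (c : ι → ℝ≥0∞) (ρ : ι → Measure (E n))
    (h : ∀ i, Bornology.IsBounded (ρ i).support) :
    Bornology.IsBounded (∑ i ∈ S, c i • ρ i).support := by
  classical
  induction S using Finset.induction_on with
  | empty => simp
  | insert a S ha ih =>
    rw [Finset.sum_insert ha, Measure.support_add]
    exact ((h a).subset (M.support_smul_subset _ _)).union ih

/-- The combination `∑ cᵢ ρᵢ` of finitely many measures of bounded support. -/
def M.combination {ι : Type*} [Fintype ι] (c : ι → ℝ≥0) (ρ : ι → Measure (E n))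
    [∀ i, IsProbabilityMeasure (ρ i)] (h : ∀ i, Bornology.IsBounded (ρ i).support) : M n where
  toMeasure := ∑ i, (c i : ℝ≥0∞) • ρ i
  finite := ⟨by
    rw [Measure.finsetSum_apply]
    refine ENNReal.sum_lt_top.2 fun i _ => ?_
    simp⟩
  bounded := isBounded_support_sum _ _ _ h

theorem tvDist_combination_le {ι : Type*} [Fintype ι] (a r : ι → ℝ≥0) (ρ : ι → Measure (E n))
    [∀ i, IsProbabilityMeasure (ρ i)] (h : ∀ i, Bornology.IsBounded (ρ i).support) :
    tvDist (M.combination a ρ h) (M.combination r ρ h) ≤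
      ENNReal.ofReal (∑ i, |(a i : ℝ) - r i|) := by
  have key := tvDist_le_of_add_eq (μ := M.combination a ρ h) (ν := M.combination r ρ h)
    (γ := (M.combination (fun i => a i - r i) ρ h).toMeasure)
    (δ := (M.combination (fun i => r i - a i) ρ h).toMeasure) (by
      simp only [M.combination, ← Finset.sum_add_distrib, ← add_smul, ← ENNReal.coe_add,
        add_tsub_eq_max, max_comm])
  refine key.trans (le_of_eq ?_)
  simp only [M.combination, Measure.finsetSum_apply, Measure.smul_apply, measure_univ, smul_eq_mul,
    mul_one, ← Finset.sum_add_distrib, ← ENNReal.coe_add]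
  rw [ENNReal.ofReal_sum_of_nonneg fun i _ => abs_nonneg _]
  refine Finset.sum_congr rfl fun i _ => ?_
  rw [← ENNReal.ofReal_coe_nnreal]
  congr 1
  rcases le_total (a i) (r i) with hle | hle
  · rw [tsub_eq_zero_of_le hle, zero_add, NNReal.coe_sub hle, abs_sub_comm, abs_of_nonneg]
    simpa using hle
  · rw [tsub_eq_zero_of_le hle, add_zero, NNReal.coe_sub hle, abs_of_nonneg]
    simpa using hle

theorem lintegral_edist_prod_le {ρ τ : Measure (E n)} [IsProbabilityMeasure ρ]
    [IsProbabilityMeasure τ] {x y : E n} {δ : ℝ} (hρ : ρ (Metric.closedBall x δ)ᶜ = 0)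
    (hτ : τ (Metric.closedBall y δ)ᶜ = 0) :
    ∫⁻ z, edist z.1 z.2 ∂(ρ.prod τ) ≤ ENNReal.ofReal (dist x y + 2 * δ) := by
  have h1 : ∀ᵐ z ∂(ρ.prod τ), z.1 ∈ Metric.closedBall x δ :=
    Measure.quasiMeasurePreserving_fst.ae (mem_ae_iff.2 hρ)
  have h2 : ∀ᵐ z ∂(ρ.prod τ), z.2 ∈ Metric.closedBall y δ :=
    Measure.quasiMeasurePreserving_snd.ae (mem_ae_iff.2 hτ)
  calc ∫⁻ z, edist z.1 z.2 ∂(ρ.prod τ)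
      ≤ ∫⁻ z, ENNReal.ofReal (dist x y + 2 * δ) ∂(ρ.prod τ) := by
        refine lintegral_mono_ae ?_
        filter_upwards [h1, h2] with z hz1 hz2
        rw [edist_dist]
        refine ENNReal.ofReal_le_ofReal ?_
        rw [Metric.mem_closedBall] at hz1 hz2
        rw [dist_comm] at hz2
        have := dist_triangle4 z.1 x y z.2
        linarith
    _ = _ := by simp

theorem W_combination_le {ι : Type*} [Fintype ι] {x : ι → E n} {δ : ℝ} (hδ : 0 ≤ δ)
    (P : ι → ι → ℝ≥0) (ρ τ : ι → Measure (E n))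
    [∀ i, IsProbabilityMeasure (ρ i)] [∀ i, IsProbabilityMeasure (τ i)]
    (hρ : ∀ i, ρ i (Metric.closedBall (x i) δ)ᶜ = 0)
    (hτ : ∀ i, τ i (Metric.closedBall (x i) δ)ᶜ = 0) :
    W (M.combination (fun i => ∑ j, P i j) ρ fun i => isBounded_support_of_measure_compl (hρ i))
      (M.combination (fun j => ∑ i, P i j) τ fun i => isBounded_support_of_measure_compl (hτ i)) ≤
      ENNReal.ofReal (∑ i, ∑ j, (P i j : ℝ) * (dist (x i) (x j) + 2 * δ)) := by
  have hmem : (∑ i, ∑ j, (P i j : ℝ≥0∞) • (ρ i).prod (τ j)) ∈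
      Plans (M.combination (fun i => ∑ j, P i j) ρ
          fun i => isBounded_support_of_measure_compl (hρ i))
        (M.combination (fun j => ∑ i, P i j) τ
          fun i => isBounded_support_of_measure_compl (hτ i)) := by
    constructor
    · ext A hA
      rw [Measure.map_apply measurable_fst hA, ← prod_univ]
      simp [M.combination, Measure.finsetSum_apply, Finset.sum_mul]
    · ext A hA
      rw [Measure.map_apply measurable_snd hA, ← univ_prod, Finset.sum_comm]
      simp [M.combination, Measure.finsetSum_apply, Finset.sum_mul]
  refine (iInf₂_le _ hmem).trans ?_
  simp only [lintegral_finsetSum_measure, lintegral_smul_measure, smul_eq_mul]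
  rw [ENNReal.ofReal_sum_of_nonneg fun i _ => Finset.sum_nonneg fun j _ => by positivity]
  refine Finset.sum_le_sum fun i _ => ?_
  rw [ENNReal.ofReal_sum_of_nonneg fun j _ => by positivity]
  refine Finset.sum_le_sum fun j _ => ?_
  rw [ENNReal.ofReal_mul (NNReal.coe_nonneg _), ENNReal.ofReal_coe_nnreal]
  gcongr
  exact lintegral_edist_prod_le (hρ i) (hτ j)

theorem exists_probability_restrict (μ : Measure (E n)) [IsFiniteMeasure μ] {C : Set (E n)}
    {x : E n} {δ : ℝ} (hδ : 0 ≤ δ) (hx : ∀ y ∈ C, dist y x ≤ δ) :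
    ∃ ρ : Measure (E n), IsProbabilityMeasure ρ ∧ μ C • ρ = μ.restrict C ∧
      ρ (Metric.closedBall x δ)ᶜ = 0 := by
  by_cases h0 : μ C = 0
  -- A null cell has no conditional law; any probability near `x` will do, since its weight is zero.
  · refine ⟨Measure.dirac x, inferInstance, ?_, ?_⟩
    · rw [h0, zero_smul, Measure.restrict_eq_zero.2 h0]
    · rw [Measure.dirac_apply' _ Metric.isClosed_closedBall.measurableSet.compl]
      simp [hδ]
  · refine ⟨(μ C)⁻¹ • μ.restrict C, ⟨?_⟩, ?_, ?_⟩
    · simp [ENNReal.inv_mul_cancel h0 (measure_ne_top μ C)]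
    · rw [smul_smul, ENNReal.mul_inv_cancel h0 (measure_ne_top μ C), one_smul]
    · rw [Measure.smul_apply,
        Measure.restrict_apply Metric.isClosed_closedBall.measurableSet.compl]
      have : (Metric.closedBall x δ)ᶜ ∩ C = ∅ := by
        ext y
        simp only [mem_inter_iff, mem_compl_iff, Metric.mem_closedBall, mem_empty_iff_false,
          iff_false]
        exact fun h => h.1 (hx y h.2)
      simp [this]

theorem restrict_biUnion_of_measure_compl {ι : Type*} (S : Finset ι) (μ : Measure (E n))
    {C : ι → Set (E n)} (hcov : μ (⋃ i ∈ S, C i)ᶜ = 0) : μ.restrict (⋃ i ∈ S, C i) = μ :=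
  Measure.restrict_eq_self_of_ae_mem (mem_ae_iff.2 hcov)

/-- Both measures are mixtures of their conditional laws `ρ i`, `τ j` on the cells. Moving `P i j`
by the product plan `ρ i × τ j` costs at most `dist (x i) (x j) + 2 * δ` per unit. The mismatch
between cell masses and row or column sums of `P` is charged to total variation, so `P` need satisfy
no constraint. -/
theorem Wg_le_transportCost {ι : Type*} [Fintype ι] (μ ν : M n) {C : ι → Set (E n)} {x : ι → E n}
    {δ : ℝ} (hδ : 0 ≤ δ) (hC : ∀ i, MeasurableSet (C i)) (hdisj : Pairwise (Function.onFun Disjoint C))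
    (hx : ∀ i, ∀ y ∈ C i, dist y (x i) ≤ δ) (hμ : μ.toMeasure (⋃ i, C i)ᶜ = 0)
    (hν : ν.toMeasure (⋃ i, C i)ᶜ = 0) (P : ι → ι → ℝ≥0) :
    Wg μ ν ≤ ENNReal.ofReal (transportCost (fun i j => dist (x i) (x j) + 2 * δ)
      (fun i => μ.toMeasure.real (C i)) (fun i => ν.toMeasure.real (C i)) P) := by
  have decomp : ∀ μ : M n, μ.toMeasure (⋃ i, C i)ᶜ = 0 → ∃ (ρ : ι → Measure (E n))
      (_ : ∀ i, IsProbabilityMeasure (ρ i)) (h : ∀ i, ρ i (Metric.closedBall (x i) δ)ᶜ = 0),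
      μ = M.combination (fun i => (μ.toMeasure (C i)).toNNReal) ρ
        fun i => isBounded_support_of_measure_compl (h i) := by
    intro μ hμ
    choose ρ h1 h2 h3 using fun i => exists_probability_restrict μ.toMeasure hδ (hx i)
    refine ⟨ρ, h1, h3, M.ext ?_⟩
    simp only [M.combination, ENNReal.coe_toNNReal (measure_ne_top μ.toMeasure _), h2]
    have hr : μ.toMeasure.restrict (⋃ i, C i) = μ.toMeasure :=
      Measure.restrict_eq_self_of_ae_mem (mem_ae_iff.2 hμ)
    rw [← Measure.sum_fintype, ← Measure.restrict_iUnion hdisj hC, hr]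
  obtain ⟨ρ, _, hρ, eμ⟩ := decomp μ hμ
  obtain ⟨τ, _, hτ, eν⟩ := decomp ν hν
  set a : ι → ℝ≥0 := fun i => (μ.toMeasure (C i)).toNNReal
  set b : ι → ℝ≥0 := fun i => (ν.toMeasure (C i)).toNNReal
  have ha : (fun i => μ.toMeasure.real (C i)) = fun i => (a i : ℝ) := rfl
  have hb : (fun i => ν.toMeasure.real (C i)) = fun i => (b i : ℝ) := rfl
  rw [ha, hb, transportCost]
  have hP : 0 ≤ ∑ i, ∑ j, (P i j : ℝ) * (dist (x i) (x j) + 2 * δ) := by positivity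
  rw [ENNReal.ofReal_add (by positivity) hP, ENNReal.ofReal_add (by positivity) (by positivity)]
  refine (iInf_le _ (M.combination (fun i => ∑ j, P i j) ρ
    fun i => isBounded_support_of_measure_compl (hρ i))).trans ((iInf_le _ (M.combination
    (fun j => ∑ i, P i j) τ fun i => isBounded_support_of_measure_compl (hτ i))).trans
    ((iInf_le _ ?_).trans ?_))
  · simp only [M.mass, M.combination, Measure.finsetSum_apply, Measure.smul_apply, measure_univ,
      smul_eq_mul, mul_one, ENNReal.ofNNReal_finsetSum]
    exact Finset.sum_comm
  · refine add_le_add (add_le_add ?_ ?_) (W_combination_le hδ P ρ τ hρ hτ)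
    · conv_lhs => rw [eμ]
      simpa using tvDist_combination_le a (fun i => ∑ j, P i j) ρ
        fun i => isBounded_support_of_measure_compl (hρ i)
    · conv_lhs => rw [eν]
      simpa using tvDist_combination_le b (fun j => ∑ i, P i j) τ
        fun i => isBounded_support_of_measure_compl (hτ i)

theorem abs_integral_sub_sum_le {ι : Type*} (S : Finset ι) (μ : Measure (E n)) [IsFiniteMeasure μ]
    {C : ι → Set (E n)} {x : ι → E n} {δ : ℝ} (hδ : 0 ≤ δ) (hC : ∀ i, MeasurableSet (C i))
    (hdisj : (S : Set ι).PairwiseDisjoint C) (hx : ∀ i ∈ S, ∀ y ∈ C i, dist y (x i) ≤ δ)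
    (hμ : μ (⋃ i ∈ S, C i)ᶜ = 0) (f : TestFun n) :
    |∫ y, f y ∂μ - ∑ i ∈ S, μ.real (C i) * f (x i)| ≤ δ * μ.real univ := by
  have h1 : ∫ y, f y ∂μ = ∑ i ∈ S, ∫ y in C i, f y ∂μ := by
    conv_lhs => rw [← restrict_biUnion_of_measure_compl S μ hμ]
    exact integral_biUnion_finset S (fun i _ => hC i) hdisj fun i _ => (f.integrable μ).integrableOn
  have h2 : ∀ i ∈ S, |∫ y in C i, f y ∂μ - μ.real (C i) * f (x i)| ≤ δ * μ.real (C i) := by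
    intro i hi
    have : ∫ y in C i, f y ∂μ - μ.real (C i) * f (x i) = ∫ y in C i, (f y - f (x i)) ∂μ := by
      rw [integral_sub (f.integrable μ).integrableOn (integrable_const _)]
      simp
    rw [this, ← Real.norm_eq_abs]
    refine norm_setIntegral_le_of_norm_le_const (measure_lt_top μ _) fun y hy => ?_
    rw [Real.norm_eq_abs, abs_le]
    have h3 := f.sub_le_dist y (x i)
    have h4 := f.sub_le_dist (x i) y
    rw [dist_comm] at h4
    have := hx i hi y hy
    constructor <;> linarith
  rw [h1, ← Finset.sum_sub_distrib]
  refine (Finset.abs_sum_le_sum_abs _ _).trans ((Finset.sum_le_sum h2).trans ?_)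
  rw [← Finset.mul_sum, ← measureReal_biUnion_finset hdisj fun i _ => hC i]
  exact mul_le_mul_of_nonneg_left (measureReal_mono (subset_univ _)) hδ

theorem lipschitzWith_inf'_dist {ι : Type*} [Fintype ι] [Nonempty ι] (x : ι → E n) (c : ι → ℝ) :
    LipschitzWith 1 fun y =>
      Finset.univ.inf' Finset.univ_nonempty fun j => dist y (x j) + c j := by
  refine LipschitzWith.of_le_add fun y z => ?_
  rw [← sub_le_iff_le_add]
  refine Finset.le_inf' _ _ fun j hj => ?_
  have h1 := Finset.inf'_le (fun j => dist y (x j) + c j) hj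
  have := dist_triangle y z (x j)
  linarith

/-- The cells are nearest-point regions, inside the ball, of an initial segment of a dense sequence;
compactness makes a finite segment suffice. Indexing by `Fin (N + 1)` keeps the index type nonempty,
as the finite infimum in the extension of the potentials requires. -/
theorem exists_partition (R δ : ℝ) (hδ : 0 < δ) : ∃ (N : ℕ) (C : Fin (N + 1) → Set (E n))
    (x : Fin (N + 1) → E n), (∀ i, MeasurableSet (C i)) ∧ Pairwise (Function.onFun Disjoint C) ∧
      (∀ i, ∀ y ∈ C i, dist y (x i) ≤ δ) ∧ Metric.closedBall 0 R ⊆ ⋃ i, C i := by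
  set e := TopologicalSpace.denseSeq (E n)
  have hK : IsCompact (Metric.closedBall (0 : E n) R) := isCompact_closedBall 0 R
  obtain ⟨t, ht⟩ := hK.elim_finite_subcover (fun k => Metric.ball (e k) δ)
    (fun k => Metric.isOpen_ball) (fun y _ => by
      obtain ⟨k, hk⟩ := (TopologicalSpace.denseRange_denseSeq (E n)).exists_dist_lt y hδ
      exact mem_iUnion.2 ⟨k, hk⟩)
  obtain ⟨N, hN⟩ := t.exists_le
  refine ⟨N, fun i => SimpleFunc.nearestPtInd e N ⁻¹' {(i : ℕ)} ∩ Metric.closedBall 0 R,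
    fun i => e i, fun i => ?_, ?_, ?_, ?_⟩
  · exact (SimpleFunc.measurableSet_preimage _ _).inter Metric.isClosed_closedBall.measurableSet
  · intro i j hij
    refine Set.disjoint_left.2 fun y hy hy' => hij (Fin.ext ?_)
    exact (hy.1 : _ = _).symm.trans hy'.1
  · rintro i y ⟨hy, hyK⟩
    obtain ⟨k, hk, hyk⟩ := mem_iUnion₂.1 (ht hyK)
    have h1 := SimpleFunc.edist_nearestPt_le e y (hN k hk)
    have h2 : SimpleFunc.nearestPt e N y = e i := by
      rw [SimpleFunc.nearestPt, SimpleFunc.map_apply, (hy : _ = _)]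
    rw [h2, edist_dist, edist_dist, ENNReal.ofReal_le_ofReal_iff dist_nonneg] at h1
    rw [dist_comm]
    rw [Metric.mem_ball, dist_comm] at hyk
    exact h1.trans hyk.le
  · intro y hy
    exact mem_iUnion.2 ⟨⟨SimpleFunc.nearestPtInd e N y,
      Nat.lt_succ_of_le (SimpleFunc.nearestPtInd_le e N y)⟩, rfl, hy⟩

/-- The nontrivial half of the duality formula for the generalized Wasserstein distance. -/
theorem exists_testFun_Wg_le (μ ν : M n) {ε : ℝ} (hε : 0 < ε) : ∃ f : TestFun n,
    Wg μ ν ≤ ENNReal.ofReal (∫ x, f x ∂μ.toMeasure - ∫ x, f x ∂ν.toMeasure + ε) := by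
  obtain ⟨R₁, hR₁⟩ := μ.exists_measure_compl_closedBall_eq_zero
  obtain ⟨R₂, hR₂⟩ := ν.exists_measure_compl_closedBall_eq_zero
  set m := μ.toMeasure.real univ
  set m' := ν.toMeasure.real univ
  have hm : 0 ≤ m := measureReal_nonneg
  have hm' : 0 ≤ m' := measureReal_nonneg
  -- Error budget: `δ * m` and `δ * m'` from replacing the integrals by sums over cells, `2 * δ *
  -- m'` from the enlarged cost, and `δ` from the near-optimality of `P`.
  obtain ⟨δ, hδ, hδε⟩ : ∃ δ : ℝ, 0 < δ ∧ δ * (m + 3 * m' + 1) ≤ ε :=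
    ⟨ε / (m + 3 * m' + 1), by positivity, by field_simp; rfl⟩
  obtain ⟨N, C, x, hC, hdisj, hx, hcov⟩ := exists_partition (n := n) (max R₁ R₂) δ hδ
  have hμ : μ.toMeasure (⋃ i, C i)ᶜ = 0 := measure_mono_null (compl_subset_compl.2
    ((Metric.closedBall_subset_closedBall (le_max_left _ _)).trans hcov)) hR₁
  have hν : ν.toMeasure (⋃ i, C i)ᶜ = 0 := measure_mono_null (compl_subset_compl.2
    ((Metric.closedBall_subset_closedBall (le_max_right _ _)).trans hcov)) hR₂
  obtain ⟨f, g, hf, hg, hfg, hP⟩ := exists_dual_of_transportCost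
    (D := fun i j => dist (x i) (x j) + 2 * δ) (fun i j => by positivity)
    (fun i => μ.toMeasure.real (C i)) (fun i => ν.toMeasure.real (C i))
  obtain ⟨P, hP⟩ := hP δ hδ
  -- This c-transform of `g` is a single Lipschitz function, at least `f i` at `x i` and at most `2
  -- * δ - g j` at `x j`. Truncation to `[-1, 1]` preserves both inequalities because `f` and `g`
  -- are bounded by `1`.
  set F : E n → ℝ := fun y =>
    Finset.univ.inf' Finset.univ_nonempty fun j => dist y (x j) + (2 * δ - g j) with hF
  have hFlip : LipschitzWith 1 F := lipschitzWith_inf'_dist x _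
  let φ : TestFun n := ⟨fun y => max (-1) (min 1 (F y)), (hFlip.const_min 1).const_max (-1),
    fun y => abs_le.2 ⟨le_max_left _ _, max_le (by norm_num) (min_le_left _ _)⟩⟩
  have hφ₁ : ∀ i, f i ≤ φ (x i) := by
    intro i
    refine le_max_of_le_right (le_min (abs_le.1 (hf i)).2 (Finset.le_inf' _ _ fun j _ => ?_))
    have := hfg i j
    linarith
  have hφ₂ : ∀ j, g j ≤ 2 * δ - φ (x j) := by
    intro j
    have h1 : φ (x j) ≤ 2 * δ - g j := by
      refine max_le ?_ ((min_le_right _ _).trans ?_)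
      · linarith [(abs_le.1 (hg j)).2]
      · refine (Finset.inf'_le _ (Finset.mem_univ j)).trans ?_
        simp
    linarith
  refine ⟨φ, (Wg_le_transportCost μ ν hδ.le hC hdisj hx hμ hν P).trans
    (ENNReal.ofReal_le_ofReal (hP.trans ?_))⟩
  have hS : ∀ ρ : Measure (E n), ρ (⋃ i, C i)ᶜ = 0 → ρ (⋃ i ∈ Finset.univ, C i)ᶜ = 0 := by
    intro ρ hρ; simpa using hρ
  have a1 := abs_le.1 (abs_integral_sub_sum_le Finset.univ μ.toMeasure hδ.le hC
    (fun i _ j _ hij => hdisj hij) (fun i _ => hx i) (hS _ hμ) φ)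
  have a2 := abs_le.1 (abs_integral_sub_sum_le Finset.univ ν.toMeasure hδ.le hC
    (fun i _ j _ hij => hdisj hij) (fun i _ => hx i) (hS _ hν) φ)
  have s1 : ∑ i, μ.toMeasure.real (C i) * f i ≤ ∑ i, μ.toMeasure.real (C i) * φ (x i) := by
    gcongr with i; exact hφ₁ i
  have s2 : ∑ i, ν.toMeasure.real (C i) * g i ≤
      2 * δ * m' - ∑ i, ν.toMeasure.real (C i) * φ (x i) := by
    have h1 : ∑ i, ν.toMeasure.real (C i) * g i ≤
        ∑ i, ν.toMeasure.real (C i) * (2 * δ - φ (x i)) := by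
      gcongr with i; exact hφ₂ i
    have h2 : ∑ i, ν.toMeasure.real (C i) ≤ m' := by
      rw [← measureReal_biUnion_finset (fun i _ j _ hij => hdisj hij) fun i _ => hC i]
      exact measureReal_mono (subset_univ _)
    simp only [mul_sub, Finset.sum_sub_distrib, ← Finset.sum_mul] at h1
    nlinarith
  nlinarith [a1.1, a2.2]

/-! ### The isometric embedding into a Banach space. -/

/-- The space in which measures are embedded: bounded functions on the test functions. -/
abbrev FlatSpace (n : ℕ) : Type := BoundedContinuousFunction (TestFun n) ℝ

/-- A measure seen as the bounded function `f ↦ ∫ f dμ` on the test functions. -/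
def flat (μ : M n) : FlatSpace n :=
  BoundedContinuousFunction.ofNormedAddCommGroupDiscrete (fun f => ∫ x, f x ∂μ.toMeasure)
    (μ.toMeasure.real univ) fun f => f.abs_integral_le _

@[simp]
theorem flat_apply (μ : M n) (f : TestFun n) : flat μ f = ∫ x, f x ∂μ.toMeasure := rfl

/-- The generalized Wasserstein distance is the flat distance. -/
theorem edist_flat (μ ν : M n) : edist (flat μ) (flat ν) = Wg μ ν := by
  apply le_antisymm
  · have key : ∀ f : TestFun n, edist (flat μ f) (flat ν f) ≤ Wg μ ν := by
      intro f
      rw [edist_dist, Real.dist_eq, flat_apply, flat_apply, abs_eq_max_neg, ENNReal.ofReal_max]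
      refine max_le (ofReal_integral_sub_integral_le_Wg f μ ν) ?_
      have := ofReal_integral_sub_integral_le_Wg f.neg μ ν
      simp only [TestFun.neg, integral_neg] at this
      rwa [neg_sub_neg, ← neg_sub] at this
    by_cases hW : Wg μ ν = ⊤
    · rw [hW]; exact le_top
    rw [edist_dist, ← ENNReal.ofReal_toReal hW]
    refine ENNReal.ofReal_le_ofReal
      ((BoundedContinuousFunction.dist_le ENNReal.toReal_nonneg).2 fun f => ?_)
    have := key f
    rwa [edist_dist, ENNReal.ofReal_le_iff_le_toReal hW] at this
  · refine ENNReal.le_of_forall_pos_le_add fun ε hε _ => ?_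
    obtain ⟨f, hf⟩ := exists_testFun_Wg_le μ ν (ε := ε) (by exact_mod_cast hε)
    refine hf.trans (ENNReal.ofReal_add_le.trans ?_)
    rw [ENNReal.ofReal_coe_nnreal, edist_dist]
    gcongr
    exact (le_abs_self _).trans (BoundedContinuousFunction.dist_coe_le_dist (f := flat μ)
      (g := flat ν) f)

theorem exists_testFun_smul {f : E n → ℝ} {K : ℝ≥0} (hf : LipschitzWith K f) {C : ℝ}
    (hC : ∀ x, |f x| ≤ C) : ∃ (c : ℝ) (g : TestFun n), ∀ x, f x = c * g x := by
  have hC0 : 0 ≤ C := (abs_nonneg _).trans (hC 0)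
  have hc : 0 < (K : ℝ) + C + 1 := by positivity
  refine ⟨K + C + 1, ⟨fun x => (K + C + 1 : ℝ)⁻¹ * f x, ?_, fun x => ?_⟩, fun x => ?_⟩
  · refine LipschitzWith.of_dist_le_mul fun x y => ?_
    rw [Real.dist_eq, ← mul_sub, abs_mul, abs_of_pos (inv_pos.2 hc), inv_mul_le_iff₀ hc,
      ← Real.dist_eq]
    refine (hf.dist_le_mul x y).trans ?_
    have := dist_nonneg (x := x) (y := y)
    simp only [NNReal.coe_one]
    nlinarith
  · rw [abs_mul, abs_of_pos (inv_pos.2 hc), inv_mul_le_iff₀ hc]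
    linarith [hC x, K.2]
  · field_simp

theorem integral_eq_of_flat_eq {μ ν : M n} (h : flat μ = flat ν) {f : E n → ℝ} {K : ℝ≥0}
    (hf : LipschitzWith K f) {C : ℝ} (hC : ∀ x, |f x| ≤ C) :
    ∫ x, f x ∂μ.toMeasure = ∫ x, f x ∂ν.toMeasure := by
  obtain ⟨c, g, hg⟩ := exists_testFun_smul hf hC
  simp only [hg, integral_const_mul, ← flat_apply, h]

/-- Thickened indicators are bounded and Lipschitz, hence multiples of test functions, and they
converge to the indicator of a closed set; closed sets determine a finite measure. -/
theorem flat_injective : Function.Injective (flat (n := n)) := by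
  intro μ ν h
  have hcl : ∀ s : Set (E n), IsClosed s → μ.toMeasure.real s = ν.toMeasure.real s := by
    intro s hs
    have key : ∀ ρ : M n, Tendsto (fun k : ℕ => ∫ y, (thickenedIndicator (δ := (1 : ℝ) / (k + 1))
        (by positivity) s y : ℝ) ∂ρ.toMeasure) atTop (𝓝 (ρ.toMeasure.real s)) := fun ρ =>
      tendsto_integral_thickenedIndicator_of_isClosed ρ.toMeasure hs
        (δs := fun k => (1 : ℝ) / (k + 1)) (fun _ => by positivity)
        tendsto_one_div_add_atTop_nhds_zero_nat
    refine tendsto_nhds_unique (key μ) ((key ν).congr fun k => ?_)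
    refine integral_eq_of_flat_eq h.symm (C := 1)
      (lipschitzWith_thickenedIndicator (δ := (1 : ℝ) / (k + 1)) (by positivity) s) fun x => ?_
    rw [abs_of_nonneg (NNReal.coe_nonneg _)]
    exact_mod_cast thickenedIndicator_le_one _ _ _
  refine M.ext (ext_of_generate_finite _ (BorelSpace.measurable_eq.trans
    borel_eq_generateFrom_isClosed) isPiSystem_isClosed (fun s hs => ?_) ?_)
  · rw [← measureReal_eq_measureReal_iff]; exact hcl s hs
  · rw [← measureReal_eq_measureReal_iff]; exact hcl univ isClosed_univ

theorem flat_add (μ ν : M n) : flat (μ + ν) = flat μ + flat ν := by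
  ext f
  exact integral_add_measure (f.integrable μ.toMeasure) (f.integrable ν.toMeasure)

theorem flat_smul (c : ℝ≥0) (μ : M n) : flat (c • μ) = (c : ℝ) • flat μ := by
  ext f
  exact integral_smul_measure _ _

theorem norm_flat (μ : M n) : ‖flat μ‖ = μ.toMeasure.real univ := by
  apply le_antisymm
  · exact (BoundedContinuousFunction.norm_le measureReal_nonneg).2 fun f => f.abs_integral_le _
  · have := (flat μ).norm_coe_le_norm TestFun.one
    rw [flat_apply] at this
    simpa [TestFun.one, abs_of_nonneg measureReal_nonneg] using this

/-- Completeness of the ambient space gives a limit that might not be a measure. Bounded masses on a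
common compact ball yield a weak limit along an ultrafilter, and each test function identifies it
with the norm limit. -/
theorem exists_tendsto_flat {u : ℕ → M n} {R : ℝ}
    (hR : ∀ k, (u k).toMeasure (Metric.closedBall 0 R)ᶜ = 0)
    (hu : CauchySeq fun k => flat (u k)) :
    ∃ μ : M n, μ.toMeasure (Metric.closedBall 0 R)ᶜ = 0 ∧
      Tendsto (fun k => flat (u k)) atTop (𝓝 (flat μ)) := by
  obtain ⟨x, hx⟩ := cauchySeq_tendsto_of_complete hu
  obtain ⟨C, hC⟩ := (isBounded_iff_forall_norm_le.1 hu.isBounded_range)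
  have hcomp := isCompact_setOfPred_finiteMeasure_le_of_isCompact C.toNNReal
    (isCompact_closedBall (0 : E n) R)
  let w : ℕ → FiniteMeasure (E n) := fun k => ⟨(u k).toMeasure, (u k).finite⟩
  let 𝒰 : Ultrafilter ℕ := Ultrafilter.of atTop
  have h𝒰 : (𝒰 : Filter ℕ) ≤ atTop := Ultrafilter.of_le _
  have hmem : ∀ k, w k ∈ {μ : FiniteMeasure (E n) | μ.mass ≤ C.toNNReal ∧
      μ (Metric.closedBall 0 R)ᶜ = 0} := by
    intro k
    constructor
    · have h1 := hC _ (mem_range_self k)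
      rw [norm_flat] at h1
      exact Real.toNNReal_le_toNNReal h1 |>.trans' (by
        rw [measureReal_def, ENNReal.toReal, Real.toNNReal_coe]; rfl)
    · rw [← ENNReal.coe_eq_zero, FiniteMeasure.ennreal_coeFn_eq_coeFn_toMeasure]
      exact hR k
  obtain ⟨μ, ⟨-, hμR⟩, hμ⟩ := isCompact_iff_ultrafilter_le_nhds'.1 hcomp (𝒰.map w)
    (Filter.mem_map.2 (Filter.Eventually.of_forall hmem))
  have hμR' : (μ : Measure (E n)) (Metric.closedBall 0 R)ᶜ = 0 := by
    rw [← FiniteMeasure.ennreal_coeFn_eq_coeFn_toMeasure, hμR, ENNReal.coe_zero]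
  refine ⟨⟨μ, inferInstance, isBounded_support_of_measure_compl hμR'⟩, hμR', ?_⟩
  convert hx
  ext f
  have hw : Tendsto w 𝒰 (𝓝 μ) := hμ
  let f' : BoundedContinuousFunction (E n) ℝ :=
    BoundedContinuousFunction.ofNormedAddCommGroup f f.continuous 1 f.abs_le_one
  have h1 := (FiniteMeasure.tendsto_iff_forall_integral_tendsto.1 hw) f'
  have h2 : Tendsto (fun k => flat (u k) f) 𝒰 (𝓝 (x f)) :=
    (((BoundedContinuousFunction.evalCLM ℝ f).continuous.tendsto x).comp hx).mono_left h𝒰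
  exact tendsto_nhds_unique h1 h2

/-- The vector field on the space of bounded functions induced by the source `s`. -/
def sourceField (s : M n → M n) : FlatSpace n → FlatSpace n :=
  -- The default `0` off the range plays no role: trajectories stay in `range flat`, and the
  -- Lipschitz bound is used only there.
  Function.extend flat (fun μ => flat (s μ)) 0

theorem sourceField_flat (s : M n → M n) (μ : M n) : sourceField s (flat μ) = flat (s μ) :=
  flat_injective.extend_apply _ _ μ

theorem lipschitzOnWith_sourceField {s : M n → M n} {L : ℝ≥0}
    (hs : ∀ μ ν : M n, Wg (s μ) (s ν) ≤ L * Wg μ ν) :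
    LipschitzOnWith L (sourceField s) (range flat) := by
  rintro _ ⟨μ, rfl⟩ _ ⟨ν, rfl⟩
  simpa only [sourceField_flat, edist_flat] using hs μ ν

theorem dist_flat_source_le {s : M n → M n} {L : ℝ≥0}
    (hs : ∀ μ ν : M n, Wg (s μ) (s ν) ≤ L * Wg μ ν) (μ ν : M n) :
    dist (flat (s μ)) (flat (s ν)) ≤ L * dist (flat μ) (flat ν) := by
  simpa only [sourceField_flat] using
    (lipschitzOnWith_sourceField hs).dist_le_mul _ (mem_range_self μ) _ (mem_range_self ν)

theorem flat_zero : flat (0 : M n) = 0 := by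
  ext f
  exact integral_zero_measure _

theorem norm_flat_source_le {s : M n → M n} {L : ℝ≥0}
    (hs : ∀ μ ν : M n, Wg (s μ) (s ν) ≤ L * Wg μ ν) (μ : M n) :
    ‖flat (s μ)‖ ≤ L * ‖flat μ‖ + ‖flat (s 0)‖ := by
  have h := dist_flat_source_le hs μ 0
  rw [flat_zero, dist_zero_right, dist_eq_norm] at h
  linarith [norm_le_norm_add_norm_sub' (flat (s μ)) (flat (s 0))]

/-! ### Estimates for the lattice discretization and the Euler scheme. -/

theorem mem_cell_iff {N : ℕ} (hN : 0 < N) {i : Fin n → ℤ} {y : E n} :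
    y ∈ cell N i ↔ ∀ j, ⌊y j * (N : ℝ) ^ 2⌋ = i j := by
  have hN' : (0 : ℝ) < (N : ℝ) ^ 2 := by positivity
  refine forall_congr' fun j => ?_
  rw [Int.floor_eq_iff, mem_Ico, latticePoint, PiLp.toLp_apply, ← add_div, div_le_iff₀ hN',
    lt_div_iff₀ hN']

theorem measurableSet_cell (N : ℕ) (i : Fin n → ℤ) : MeasurableSet (cell N i) := by
  have : cell N i = ⋂ j, (fun y : E n => y j) ⁻¹'
      Ico (latticePoint N i j) (latticePoint N i j + 1 / (N : ℝ) ^ 2) := by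
    ext y; simp [cell]
  rw [this]
  exact MeasurableSet.iInter fun j => (by fun_prop : Measurable fun y : E n => y j) measurableSet_Ico

theorem pairwiseDisjoint_cell {N : ℕ} (hN : 0 < N) (S : Set (Fin n → ℤ)) :
    S.PairwiseDisjoint (cell N) := fun _ _ _ _ hij =>
  Set.disjoint_left.2 fun _ hy hy' => hij (funext fun k =>
    ((mem_cell_iff hN).1 hy k).symm.trans ((mem_cell_iff hN).1 hy' k))

theorem dist_latticePoint_le {N : ℕ} {i : Fin n → ℤ} {y : E n} (hy : y ∈ cell N i) :
    dist y (latticePoint N i) ≤ √n / (N : ℝ) ^ 2 := by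
  rw [EuclideanSpace.dist_eq]
  calc √(∑ j, dist (y j) (latticePoint N i j) ^ 2)
      ≤ √(∑ _j : Fin n, (1 / (N : ℝ) ^ 2) ^ 2) := by
        refine Real.sqrt_le_sqrt (Finset.sum_le_sum fun j _ => ?_)
        have := hy j
        gcongr
        rw [Real.dist_eq, abs_of_nonneg (by linarith [this.1])]
        linarith [this.2]
    _ = √n / (N : ℝ) ^ 2 := by
        rw [Finset.sum_const, Finset.card_univ, Fintype.card_fin, nsmul_eq_mul,
          Real.sqrt_mul (by positivity), Real.sqrt_sq (by positivity)]
        ring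

theorem closedBall_subset_iUnion_cell {N : ℕ} (hN : 0 < N) :
    Metric.closedBall (0 : E n) N ⊆ ⋃ i ∈ latticeIndex n N, cell N i := by
  intro y hy
  refine mem_iUnion₂.2 ⟨fun j => ⌊y j * (N : ℝ) ^ 2⌋, ?_, (mem_cell_iff hN).2 fun j => rfl⟩
  refine Fintype.mem_piFinset.2 fun j => Finset.mem_Icc.2 ?_
  have h1 : |y j| ≤ N := (PiLp.norm_apply_le y j).trans (by simpa using hy)
  have h2 := abs_le.1 h1
  have hN' : (0 : ℝ) < (N : ℝ) ^ 2 := by positivity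
  constructor
  · rw [Int.le_floor]
    push_cast
    nlinarith [h2.1]
  · have h3 : (⌊y j * (N : ℝ) ^ 2⌋ : ℝ) ≤ (N : ℝ) ^ 3 :=
      (Int.floor_le _).trans (by nlinarith [h2.2])
    exact_mod_cast h3

theorem integral_discretize (N : ℕ) (μ : M n) (f : TestFun n) :
    ∫ x, f x ∂(discretize N μ).toMeasure =
      ∑ i ∈ latticeIndex n N, μ.toMeasure.real (cell N i) * f (latticePoint N i) := by
  rw [discretize, integral_finsetSum_measure fun i _ =>
    (f.integrable _).smul_measure (measure_ne_top _ _)]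
  simp [integral_smul_measure, measureReal_def]

theorem dist_flat_discretize_le {N : ℕ} (hN : 0 < N) (μ : M n)
    (hμ : μ.toMeasure (Metric.closedBall 0 N)ᶜ = 0) :
    dist (flat (discretize N μ)) (flat μ) ≤ √n / (N : ℝ) ^ 2 * ‖flat μ‖ := by
  refine (BoundedContinuousFunction.dist_le (by positivity)).2 fun f => ?_
  rw [dist_comm, Real.dist_eq, flat_apply, flat_apply, integral_discretize, norm_flat]
  exact abs_integral_sub_sum_le _ μ.toMeasure (by positivity) (measurableSet_cell N)
    (pairwiseDisjoint_cell hN _) (fun i _ y hy => dist_latticePoint_le hy)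
    (measure_mono_null (compl_subset_compl.2 (closedBall_subset_iUnion_cell hN)) hμ) f

theorem norm_flat_discretize_le {N : ℕ} (hN : 0 < N) (μ : M n) :
    ‖flat (discretize N μ)‖ ≤ ‖flat μ‖ := by
  rw [norm_flat, norm_flat]
  have h : (discretize N μ).toMeasure.real univ =
      ∑ i ∈ latticeIndex n N, μ.toMeasure.real (cell N i) := by
    have := integral_discretize N μ TestFun.one
    simpa [TestFun.one] using this
  rw [h, ← measureReal_biUnion_finset (pairwiseDisjoint_cell hN _)
    fun i _ => measurableSet_cell N i]
  exact measureReal_mono (subset_univ _)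

/-- A lattice point receives mass only from its own cell, within distance `√n / N ^ 2 ≤ √n`. The
enlarged radius is independent of `N`, which the compactness argument needs. -/
theorem discretize_compl_closedBall {N : ℕ} (hN : 0 < N) {μ : M n} {R : ℝ}
    (hμ : μ.toMeasure (Metric.closedBall 0 R)ᶜ = 0) :
    (discretize N μ).toMeasure (Metric.closedBall 0 (R + √n))ᶜ = 0 := by
  rw [discretize, Measure.finsetSum_apply]
  refine Finset.sum_eq_zero fun i _ => ?_
  rw [Measure.smul_apply, smul_eq_mul, mul_eq_zero, or_iff_not_imp_right]
  intro h
  refine measure_mono_null (t := (Metric.closedBall 0 R)ᶜ) (fun y hy hyR => h ?_) hμ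
  rw [Measure.dirac_apply' _ Metric.isClosed_closedBall.measurableSet.compl]
  refine indicator_of_notMem (notMem_compl_iff.2 ?_) _
  rw [Metric.mem_closedBall] at hyR ⊢
  have h1 := dist_latticePoint_le hy
  have h2 : √n / (N : ℝ) ^ 2 ≤ √n :=
    div_le_self (Real.sqrt_nonneg _) (one_le_pow₀ (by exact_mod_cast hN))
  rw [dist_comm] at h1
  linarith [dist_triangle (latticePoint N i) y 0]

theorem flat_eulerStep_succ (s : M n → M n) (μ₀ : M n) (N k : ℕ) :
    flat (eulerStep s μ₀ N (k + 1)) = flat (eulerStep s μ₀ N k) +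
      (1 / N : ℝ) • flat (discretize N (s (eulerStep s μ₀ N k))) := by
  rw [eulerStep, flat_add, flat_smul]
  simp

theorem flat_latticeSolution (s : M n → M n) (μ₀ : M n) {N : ℕ} (hN : 0 < N) {t : ℝ}
    (ht : 0 ≤ t) : flat (latticeSolution s μ₀ N t) = flat (eulerStep s μ₀ N ⌊t * N⌋₊) +
      (t - ⌊t * N⌋₊ / N) • flat (discretize N (s (eulerStep s μ₀ N ⌊t * N⌋₊))) := by
  have hN' : (0 : ℝ) < N := by exact_mod_cast hN
  have h : 0 ≤ t - ⌊t * N⌋₊ / N := by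
    rw [sub_nonneg, div_le_iff₀ hN']
    exact Nat.floor_le (by positivity)
  rw [latticeSolution, flat_add, flat_smul, Real.coe_toNNReal _ h]

theorem flat_latticeSolution_of_mem (s : M n → M n) (μ₀ : M n) {N : ℕ} (hN : 0 < N) {k : ℕ} {t : ℝ}
    (ht : t ∈ Icc (k / N : ℝ) ((k + 1) / N)) :
    flat (latticeSolution s μ₀ N t) = flat (eulerStep s μ₀ N k) +
      (t - k / N) • flat (discretize N (s (eulerStep s μ₀ N k))) := by
  have hN' : (0 : ℝ) < N := by exact_mod_cast hN
  have ht0 : 0 ≤ t := le_trans (by positivity) ht.1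
  rw [flat_latticeSolution s μ₀ hN ht0]
  rcases ht.2.eq_or_lt with h | h
  -- At the right endpoint the floor has already jumped, but the next Euler value equals the
  -- extrapolation from step `k`.
  · have hf : ⌊t * N⌋₊ = k + 1 := by
      rw [h, div_mul_cancel₀ _ hN'.ne']
      exact_mod_cast Nat.floor_natCast (R := ℝ) (k + 1)
    rw [hf, flat_eulerStep_succ, h]
    push_cast
    rw [sub_self, zero_smul, add_zero, ← sub_div, add_sub_cancel_left]
  · have hf : ⌊t * N⌋₊ = k := by
      rw [Nat.floor_eq_iff (by positivity)]
      exact ⟨(div_le_iff₀ hN').1 ht.1, (lt_div_iff₀ hN').1 h⟩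
    rw [hf]

theorem mem_Ico_floor_div {N : ℕ} (hN : 0 < N) {t : ℝ} (ht : 0 ≤ t) :
    t ∈ Ico (⌊t * N⌋₊ / N : ℝ) ((⌊t * N⌋₊ + 1) / N) := by
  have hN' : (0 : ℝ) < N := by exact_mod_cast hN
  rw [mem_Ico, div_le_iff₀ hN', lt_div_iff₀ hN']
  exact ⟨Nat.floor_le (by positivity), Nat.lt_floor_add_one _⟩

theorem continuousOn_flat_latticeSolution (s : M n → M n) (μ₀ : M n) {N : ℕ} (hN : 0 < N) (T : ℝ) :
    ContinuousOn (fun t => flat (latticeSolution s μ₀ N t)) (Icc 0 T) := by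
  have hN' : (0 : ℝ) < N := by exact_mod_cast hN
  have key : ∀ k : ℕ, ContinuousOn (fun t => flat (latticeSolution s μ₀ N t)) (Icc 0 (k / N)) := by
    intro k
    induction k with
    | zero => simp
    | succ k ih =>
      have hstep : ContinuousOn (fun t => flat (latticeSolution s μ₀ N t))
          (Icc (k / N) ((k + 1) / N)) := by
        refine ContinuousOn.congr ?_ fun t ht => flat_latticeSolution_of_mem s μ₀ hN ht
        fun_prop
      have hunion : Icc 0 (k / N : ℝ) ∪ Icc (k / N : ℝ) ((k + 1) / N) = Icc 0 ((k + 1) / N : ℝ) :=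
        Icc_union_Icc_eq_Icc (by positivity) (by gcongr; linarith)
      push_cast
      rw [← hunion]
      exact ih.union_of_isClosed hstep isClosed_Icc isClosed_Icc
  obtain ⟨k, hk⟩ := exists_nat_ge (T * N)
  exact (key k).mono (Icc_subset_Icc_right ((le_div_iff₀ hN').2 hk))

theorem hasDerivWithinAt_flat_latticeSolution (s : M n → M n) (μ₀ : M n) {N : ℕ} (hN : 0 < N)
    {t : ℝ} (ht : 0 ≤ t) : HasDerivWithinAt (fun t => flat (latticeSolution s μ₀ N t))
      (flat (discretize N (s (eulerStep s μ₀ N ⌊t * N⌋₊)))) (Ici t) t := by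
  have hmem := mem_Ico_floor_div hN ht
  set k := ⌊t * N⌋₊
  have hd : HasDerivAt (fun τ : ℝ => flat (eulerStep s μ₀ N k) +
      (τ - k / N) • flat (discretize N (s (eulerStep s μ₀ N k))))
      (flat (discretize N (s (eulerStep s μ₀ N k)))) t := by
    simpa using (((hasDerivAt_id t).sub_const (k / N : ℝ)).smul_const
      (flat (discretize N (s (eulerStep s μ₀ N k))))).const_add (flat (eulerStep s μ₀ N k))
  refine hd.hasDerivWithinAt.congr_of_eventuallyEq ?_
    (flat_latticeSolution_of_mem s μ₀ hN (Ico_subset_Icc_self hmem))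
  filter_upwards [Ico_mem_nhdsGE hmem.2] with τ hτ
  exact flat_latticeSolution_of_mem s μ₀ hN ⟨hmem.1.trans hτ.1, hτ.2.le⟩

theorem norm_flat_add (μ ν : M n) : ‖flat (μ + ν)‖ = ‖flat μ‖ + ‖flat ν‖ := by
  rw [norm_flat, norm_flat, norm_flat]
  exact measureReal_add_apply

/-- Since the source is positive, mass never decreases in time. The delayed value in the scheme is
thus controlled by the current one, which lets Grönwall's inequality close. -/
theorem norm_flat_eulerStep_le (s : M n → M n) (μ₀ : M n) (N : ℕ) (t : ℝ) :
    ‖flat (eulerStep s μ₀ N ⌊t * N⌋₊)‖ ≤ ‖flat (latticeSolution s μ₀ N t)‖ := by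
  rw [latticeSolution, norm_flat_add]
  linarith [norm_nonneg (flat ((t - ⌊t * N⌋₊ / N).toNNReal •
    discretize N (s (eulerStep s μ₀ N ⌊t * N⌋₊))))]

theorem measure_add_compl_eq_zero {μ ν : M n} {A : Set (E n)} (hμ : μ.toMeasure A = 0)
    (hν : ν.toMeasure A = 0) (c : ℝ≥0) : (μ + c • ν).toMeasure A = 0 := by
  change (μ.toMeasure + (c : ℝ≥0∞) • ν.toMeasure) A = 0
  simp [hμ, hν]

theorem eulerStep_compl_closedBall {s : M n → M n} {μ₀ : M n} {R : ℝ}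
    (hμ₀ : μ₀.toMeasure (Metric.closedBall 0 R)ᶜ = 0)
    (hs : ∀ μ, (s μ).toMeasure (Metric.closedBall 0 R)ᶜ = 0) {N : ℕ} (hN : 0 < N) (k : ℕ) :
    (eulerStep s μ₀ N k).toMeasure (Metric.closedBall 0 (R + √n))ᶜ = 0 := by
  induction k with
  | zero => exact discretize_compl_closedBall hN hμ₀
  | succ k ih => exact measure_add_compl_eq_zero ih (discretize_compl_closedBall hN (hs _)) _

theorem latticeSolution_compl_closedBall {s : M n → M n} {μ₀ : M n} {R : ℝ}
    (hμ₀ : μ₀.toMeasure (Metric.closedBall 0 R)ᶜ = 0)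
    (hs : ∀ μ, (s μ).toMeasure (Metric.closedBall 0 R)ᶜ = 0) {N : ℕ} (hN : 0 < N) (t : ℝ) :
    (latticeSolution s μ₀ N t).toMeasure (Metric.closedBall 0 (R + √n))ᶜ = 0 :=
  measure_add_compl_eq_zero (eulerStep_compl_closedBall hμ₀ hs hN _)
    (discretize_compl_closedBall hN (hs _)) _

/-! ### Uniform convergence of the lattice solutions. -/

/-- One constant, depending only on `K` and `T`, reduces convergence to the vanishing of the initial
error `δ` and the drift error `ε`. -/
theorem exists_gronwallBound_le (K : ℝ≥0) {T : ℝ} (hT : 0 ≤ T) : ∃ A : ℝ, 0 ≤ A ∧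
    ∀ δ ε : ℝ, 0 ≤ δ → 0 ≤ ε → ∀ t ∈ Icc 0 T, gronwallBound δ K ε t ≤ A * (δ + ε) := by
  rcases eq_or_ne K 0 with rfl | hK
  · refine ⟨1 + T, by positivity, fun δ ε hδ hε t ht => ?_⟩
    rw [NNReal.coe_zero, gronwallBound_K0]
    simp only
    nlinarith [mul_le_mul_of_nonneg_left ht.2 hε, mul_nonneg hT hδ]
  · have hK' : (0 : ℝ) < K := by positivity
    refine ⟨Real.exp (K * T) + Real.exp (K * T) / K, by positivity, fun δ ε hδ hε t ht => ?_⟩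
    rw [gronwallBound_of_K_ne_0 hK'.ne']
    have h1 : Real.exp (K * t) ≤ Real.exp (K * T) := by
      gcongr; exact ht.2
    calc δ * Real.exp (K * t) + ε / K * (Real.exp (K * t) - 1)
        ≤ δ * Real.exp (K * T) + ε / K * Real.exp (K * T) := by
          gcongr
          linarith
      _ ≤ δ * Real.exp (K * T) + ε / K * Real.exp (K * T) +
          (ε * Real.exp (K * T) + δ / K * Real.exp (K * T)) :=
          le_add_of_nonneg_right (by positivity)
      _ = _ := by ring

theorem exists_norm_flat_latticeSolution_le {s : M n → M n} {L : ℝ≥0}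
    (hs : ∀ μ ν : M n, Wg (s μ) (s ν) ≤ L * Wg μ ν) (μ₀ : M n) {T : ℝ} (hT : 0 ≤ T) :
    ∃ B : ℝ, 0 ≤ B ∧ ∀ N : ℕ, 0 < N → ∀ t ∈ Icc 0 T,
      ‖flat (latticeSolution s μ₀ N t)‖ ≤ B := by
  obtain ⟨A, hA, hbound⟩ := exists_gronwallBound_le L hT
  refine ⟨A * (‖flat μ₀‖ + ‖flat (s 0)‖), by positivity, fun N hN t ht => ?_⟩
  have h0 : ‖flat (latticeSolution s μ₀ N 0)‖ ≤ ‖flat μ₀‖ := by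
    rw [flat_latticeSolution s μ₀ hN le_rfl]
    simpa [eulerStep] using norm_flat_discretize_le hN μ₀
  have := norm_le_gronwallBound_of_norm_deriv_right_le (K := L) (ε := ‖flat (s 0)‖)
    (continuousOn_flat_latticeSolution s μ₀ hN T)
    (fun t ht => hasDerivWithinAt_flat_latticeSolution s μ₀ hN ht.1) h0 (fun t ht => by
      refine (norm_flat_discretize_le hN _).trans ((norm_flat_source_le hs _).trans ?_)
      gcongr
      exact norm_flat_eulerStep_le s μ₀ N t) t ht
  rw [sub_zero] at this
  exact this.trans (hbound _ _ (norm_nonneg _) (norm_nonneg _) t ht)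

/-- The lattice approximate solutions solve the equation up to an error tending to `0`. -/
theorem exists_approximation_error {s : M n → M n} {L : ℝ≥0}
    (hs : ∀ μ ν : M n, Wg (s μ) (s ν) ≤ L * Wg μ ν) {R : ℝ}
    (hsR : ∀ μ, (s μ).toMeasure (Metric.closedBall 0 R)ᶜ = 0) (μ₀ : M n) {T : ℝ} (hT : 0 ≤ T) :
    ∃ ε : ℕ → ℝ, Tendsto ε atTop (𝓝 0) ∧ ∀ᶠ N in atTop, 0 ≤ ε N ∧ ∀ t ∈ Icc 0 T,
      dist (flat (discretize N (s (eulerStep s μ₀ N ⌊t * N⌋₊))))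
        (flat (s (latticeSolution s μ₀ N t))) ≤ ε N := by
  obtain ⟨B, hB, hbound⟩ := exists_norm_flat_latticeSolution_le hs μ₀ hT
  set c := L * B + ‖flat (s 0)‖
  have hc : 0 ≤ c := by positivity
  -- The first term is the discretization error of the source, of mass at most `c`; the second is
  -- the delay error, as the curve moves by at most `c / N` within a step.
  have hlim : Tendsto (fun N : ℕ => √n / (N : ℝ) ^ 2 * c + L * (1 / N * c)) atTop (𝓝 0) := by
    have h1 : Tendsto (fun N : ℕ => 1 / (N : ℝ)) atTop (𝓝 0) := tendsto_one_div_atTop_nhds_zero_nat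
    have h2 : Tendsto (fun N : ℕ => √n * (1 / (N : ℝ) * (1 / (N : ℝ))) * c + L * (1 / N * c)) atTop
        (𝓝 (√n * (0 * 0) * c + L * (0 * c))) :=
      (((h1.mul h1).const_mul _).mul_const _).add ((h1.mul_const _).const_mul _)
    simp only [mul_zero, zero_mul, add_zero] at h2
    refine h2.congr fun N => ?_
    ring
  refine ⟨_, hlim, ?_⟩
  filter_upwards [eventually_gt_atTop 0, eventually_ge_atTop ⌈R⌉₊] with N hN hNR
  refine ⟨by positivity, fun t ht => ?_⟩
  have hN' : (0 : ℝ) < N := by exact_mod_cast hN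
  have hRN : R ≤ N := (Nat.le_ceil R).trans (by exact_mod_cast hNR)
  set ρ := eulerStep s μ₀ N ⌊t * N⌋₊ with hρ
  have hsρ : ‖flat (s ρ)‖ ≤ c := (norm_flat_source_le hs ρ).trans (by
    have := (norm_flat_eulerStep_le s μ₀ N t).trans (hbound N hN t ht)
    change L * ‖flat ρ‖ + _ ≤ L * B + _
    gcongr)
  have h1 : dist (flat (discretize N (s ρ))) (flat (s ρ)) ≤ √n / (N : ℝ) ^ 2 * c :=
    (dist_flat_discretize_le hN _ (measure_mono_null (compl_subset_compl.2
      (Metric.closedBall_subset_closedBall hRN)) (hsR ρ))).trans (by gcongr)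
  have hmem := mem_Ico_floor_div hN ht.1
  have h2 : dist (flat ρ) (flat (latticeSolution s μ₀ N t)) ≤ 1 / N * c := by
    rw [flat_latticeSolution s μ₀ hN ht.1, dist_self_add_right, norm_smul, Real.norm_eq_abs,
      abs_of_nonneg (sub_nonneg.2 hmem.1)]
    have h3 : t - ⌊t * N⌋₊ / N ≤ 1 / N := by
      have := hmem.2.le
      rw [add_div] at this
      linarith
    have h4 := (norm_flat_discretize_le hN (s ρ)).trans hsρ
    gcongr
  refine (dist_triangle _ (flat (s ρ)) _).trans (add_le_add h1 ?_)
  exact (dist_flat_source_le hs _ _).trans (by gcongr)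

theorem hasDerivWithinAt_of_eq_integral {X : Type*} [NormedAddCommGroup X] [NormedSpace ℝ X]
    [CompleteSpace X] {u w : ℝ → X} {x₀ : X} {T : ℝ} (hT : 0 ≤ T) (hw : ContinuousOn w (Icc 0 T))
    (h : ∀ t ∈ Icc 0 T, u t = x₀ + ∫ τ in 0..t, w τ) {t : ℝ} (ht : t ∈ Icc 0 T) :
    HasDerivWithinAt u (w t) (Icc 0 T) t := by
  -- Extending `w` by constants makes it continuous on the line, so the two-sided fundamental
  -- theorem of calculus applies even at the endpoints.
  let w' : ℝ → X := IccExtend hT ((Icc 0 T).domRestrict w)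
  have hw' : Continuous w' := (continuousOn_iff_continuous_domRestrict.1 hw).Icc_extend'
  have heq : ∀ τ ∈ Icc 0 T, w' τ = w τ := fun τ hτ => IccExtend_of_mem hT _ hτ
  have hd : HasDerivAt (fun t => x₀ + ∫ τ in 0..t, w' τ) (w' t) t :=
    (hw'.integral_hasStrictDerivAt 0 t).hasDerivAt.const_add x₀
  rw [heq t ht] at hd
  have hu : ∀ t ∈ Icc 0 T, u t = x₀ + ∫ τ in 0..t, w' τ := by
    intro t ht
    rw [h t ht]
    congr 1
    refine intervalIntegral.integral_congr fun τ hτ => ?_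
    rw [uIcc_of_le ht.1] at hτ
    exact (heq τ ⟨hτ.1, hτ.2.trans ht.2⟩).symm
  exact hd.hasDerivWithinAt.congr hu (hu t ht)

theorem continuousOn_flat_source {s : M n → M n} {L : ℝ≥0}
    (hs : ∀ μ ν : M n, Wg (s μ) (s ν) ≤ L * Wg μ ν) {μ : ℝ → M n} {S : Set ℝ}
    (hμ : ContinuousOn (fun t => flat (μ t)) S) : ContinuousOn (fun t => flat (s (μ t))) S := by
  refine ((lipschitzOnWith_sourceField hs).continuousOn.comp hμ
    fun t _ => mem_range_self _).congr fun t _ => ?_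
  exact (sourceField_flat s _).symm

/-- Both curves are approximate trajectories of the same Lipschitz field, so Grönwall's inequality
compares them. -/
theorem dist_latticeSolution_le {s : M n → M n} {L : ℝ≥0}
    (hs : ∀ μ ν : M n, Wg (s μ) (s ν) ≤ L * Wg μ ν) (μ₀ : M n) {T A : ℝ}
    (hA : ∀ δ ε : ℝ, 0 ≤ δ → 0 ≤ ε → ∀ t ∈ Icc 0 T, gronwallBound δ L ε t ≤ A * (δ + ε))
    {d ε : ℕ → ℝ} {N N' : ℕ} (hN : 0 < N) (hN' : 0 < N')
    (hd : dist (flat (discretize N μ₀)) (flat μ₀) ≤ d N)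
    (hd' : dist (flat (discretize N' μ₀)) (flat μ₀) ≤ d N') (hε₀ : 0 ≤ ε N) (hε₀' : 0 ≤ ε N')
    (hε : ∀ t ∈ Icc 0 T, dist (flat (discretize N (s (eulerStep s μ₀ N ⌊t * N⌋₊))))
        (flat (s (latticeSolution s μ₀ N t))) ≤ ε N)
    (hε' : ∀ t ∈ Icc 0 T, dist (flat (discretize N' (s (eulerStep s μ₀ N' ⌊t * N'⌋₊))))
        (flat (s (latticeSolution s μ₀ N' t))) ≤ ε N') {t : ℝ} (ht : t ∈ Icc 0 T) :
    dist (flat (latticeSolution s μ₀ N t)) (flat (latticeSolution s μ₀ N' t)) ≤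
      A * (d N + ε N + (d N' + ε N')) := by
  have h0 : ∀ N : ℕ, 0 < N → flat (latticeSolution s μ₀ N 0) = flat (discretize N μ₀) := by
    intro N hN
    rw [flat_latticeSolution s μ₀ hN le_rfl]
    simp [eulerStep]
  have h := dist_le_of_approx_trajectories_ODE_of_mem (v := fun _ => sourceField s) (K := L)
    (s := fun _ => range flat) (δ := d N + d N') (εf := ε N) (εg := ε N')
    (fun t _ => lipschitzOnWith_sourceField hs)
    (continuousOn_flat_latticeSolution s μ₀ hN T)
    (fun t ht => hasDerivWithinAt_flat_latticeSolution s μ₀ hN ht.1)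
    (fun t ht => by rw [sourceField_flat]; exact hε t (Ico_subset_Icc_self ht))
    (fun t _ => mem_range_self _)
    (continuousOn_flat_latticeSolution s μ₀ hN' T)
    (fun t ht => hasDerivWithinAt_flat_latticeSolution s μ₀ hN' ht.1)
    (fun t ht => by rw [sourceField_flat]; exact hε' t (Ico_subset_Icc_self ht))
    (fun t _ => mem_range_self _)
    (by
      rw [h0 N hN, h0 N' hN']
      exact (dist_triangle_right _ _ (flat μ₀)).trans (add_le_add hd hd')) t ht
  rw [sub_zero] at h
  refine h.trans ((hA _ _ (add_nonneg (dist_nonneg.trans hd) (dist_nonneg.trans hd'))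
    (add_nonneg hε₀ hε₀') t ht).trans (le_of_eq ?_))
  ring

theorem tendsto_flat_discretize (μ : M n) : ∃ d : ℕ → ℝ, Tendsto d atTop (𝓝 0) ∧
    ∀ᶠ N in atTop, dist (flat (discretize N μ)) (flat μ) ≤ d N := by
  obtain ⟨R, hR⟩ := μ.exists_measure_compl_closedBall_eq_zero
  refine ⟨fun N => √n / (N : ℝ) ^ 2 * ‖flat μ‖, ?_, ?_⟩
  · have h1 : Tendsto (fun N : ℕ => (N : ℝ) ^ 2) atTop atTop :=
      (tendsto_pow_atTop two_ne_zero).comp tendsto_natCast_atTop_atTop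
    simpa using (h1.const_div_atTop √n).mul_const ‖flat μ‖
  · filter_upwards [eventually_gt_atTop 0, eventually_ge_atTop ⌈R⌉₊] with N hN hNR
    have hRN : R ≤ N := (Nat.le_ceil R).trans (by exact_mod_cast hNR)
    exact dist_flat_discretize_le hN _ (measure_mono_null (compl_subset_compl.2
      (Metric.closedBall_subset_closedBall hRN)) hR)

/-- The lattice approximate solutions converge uniformly to a curve of measures solving the
integral equation. -/
theorem exists_limit_latticeSolution {s : M n → M n} {L : ℝ≥0}
    (hs : ∀ μ ν : M n, Wg (s μ) (s ν) ≤ L * Wg μ ν) {R : ℝ}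
    (hsR : ∀ μ, (s μ).toMeasure (Metric.closedBall 0 R)ᶜ = 0) (μ₀ : M n)
    (hμ₀ : μ₀.toMeasure (Metric.closedBall 0 R)ᶜ = 0) {T : ℝ} (hT : 0 ≤ T) :
    ∃ (μ : ℝ → M n) (e : ℕ → ℝ), Tendsto e atTop (𝓝 0) ∧
      (∀ᶠ N in atTop, ∀ t ∈ Icc 0 T,
        dist (flat (latticeSolution s μ₀ N t)) (flat (μ t)) ≤ e N) ∧
      ContinuousOn (fun t => flat (μ t)) (Icc 0 T) ∧
      ∀ t ∈ Icc 0 T, flat (μ t) = flat μ₀ + ∫ τ in 0..t, flat (s (μ τ)) := by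
  obtain ⟨A, hA, hgron⟩ := exists_gronwallBound_le L hT
  obtain ⟨d, hd, hdev⟩ := tendsto_flat_discretize μ₀
  obtain ⟨ε, hε, hεev⟩ := exists_approximation_error hs hsR μ₀ hT
  have hη : Tendsto (fun N => d N + ε N) atTop (𝓝 0) := by simpa using hd.add hε
  have hbase := (eventually_gt_atTop 0).and (hdev.and hεev)
  have hcau : ∀ t ∈ Icc 0 T, CauchySeq fun N => flat (latticeSolution s μ₀ N t) := by
    intro t ht
    rw [cauchySeq_iff_tendsto_dist_atTop_0, ← prod_atTop_atTop_eq]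
    have hlim : Tendsto (fun p : ℕ × ℕ => A * (d p.1 + ε p.1 + (d p.2 + ε p.2)))
        (atTop ×ˢ atTop) (𝓝 0) := by
      simpa using ((hη.comp tendsto_fst).add (hη.comp tendsto_snd)).const_mul A
    refine squeeze_zero' (Eventually.of_forall fun p => dist_nonneg) ?_ hlim
    filter_upwards [hbase.prod_mk hbase] with p hp
    obtain ⟨⟨h1, h2, h3, h4⟩, h1', h2', h3', h4'⟩ := hp
    exact dist_latticeSolution_le hs μ₀ hgron h1 h1' h2 h2' h3 h3' h4 h4' ht
  have hex : ∀ t, ∃ ρ : M n, t ∈ Icc 0 T →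
      Tendsto (fun N => flat (latticeSolution s μ₀ N t)) atTop (𝓝 (flat ρ)) := by
    intro t
    by_cases ht : t ∈ Icc 0 T
    · obtain ⟨ρ, -, hρ⟩ := exists_tendsto_flat
        -- The sequence is shifted by one because the support bound excludes `N = 0`.
        (fun k => latticeSolution_compl_closedBall hμ₀ hsR k.succ_pos t)
        ((hcau t ht).comp_tendsto (tendsto_add_atTop_nat 1))
      exact ⟨ρ, fun _ => (tendsto_add_atTop_iff_nat 1).1 hρ⟩
    · exact ⟨0, fun h => absurd h ht⟩
  choose μ hμ using hex
  have hbound : ∀ᶠ N in atTop, ∀ t ∈ Icc 0 T,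
      dist (flat (latticeSolution s μ₀ N t)) (flat (μ t)) ≤ A * (d N + ε N) := by
    filter_upwards [hbase] with N hN t ht
    obtain ⟨h1, h2, h3, h4⟩ := hN
    have hlim : Tendsto (fun N' => A * (d N + ε N + (d N' + ε N'))) atTop
        (𝓝 (A * (d N + ε N))) := by
      simpa using (hη.const_add (d N + ε N)).const_mul A
    -- Sending `N'` to infinity in the Cauchy estimate keeps a bound independent of `t`.
    refine le_of_tendsto_of_tendsto (tendsto_const_nhds.dist (hμ t ht)) hlim ?_
    filter_upwards [hbase] with N' hN'
    obtain ⟨h1', h2', h3', h4'⟩ := hN'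
    exact dist_latticeSolution_le hs μ₀ hgron h1 h1' h2 h2' h3 h3' h4 h4' ht
  have he : Tendsto (fun N => A * (d N + ε N)) atTop (𝓝 0) := by simpa using hη.const_mul A
  have hcont : ContinuousOn (fun t => flat (μ t)) (Icc 0 T) := by
    have hunif : TendstoUniformlyOn (fun N t => flat (latticeSolution s μ₀ N t))
        (fun t => flat (μ t)) atTop (Icc 0 T) := by
      rw [Metric.tendstoUniformlyOn_iff]
      intro r hr
      filter_upwards [hbound, he.eventually_lt_const hr] with N h1 h2 t ht
      rw [dist_comm]
      exact (h1 t ht).trans_lt h2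
    refine hunif.continuousOn (Eventually.frequently ?_)
    filter_upwards [eventually_gt_atTop 0] with N hN
    exact continuousOn_flat_latticeSolution s μ₀ hN T
  refine ⟨μ, _, he, hbound, hcont, fun t ht => ?_⟩
  have hw : ContinuousOn (fun τ => flat (s (μ τ))) (Icc 0 T) := continuousOn_flat_source hs hcont
  have hsub : uIcc 0 t ⊆ Icc 0 T := by
    rw [uIcc_of_le ht.1]; exact Icc_subset_Icc_right ht.2
  have hwint : IntervalIntegrable (fun τ => flat (s (μ τ))) volume 0 t :=
    (hw.mono hsub).intervalIntegrable
  set g : ℕ → ℝ → FlatSpace n := fun N τ => flat (discretize N (s (eulerStep s μ₀ N ⌊τ * N⌋₊)))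
    with hg
  have hgw : ∀ᶠ N in atTop, ∀ τ ∈ Icc 0 T,
      ‖g N τ - flat (s (μ τ))‖ ≤ ε N + L * (A * (d N + ε N)) := by
    filter_upwards [hbase, hbound] with N hN hb τ hτ
    rw [← dist_eq_norm]
    refine (dist_triangle _ (flat (s (latticeSolution s μ₀ N τ))) _).trans
      (add_le_add (hN.2.2.2 τ hτ) ((dist_flat_source_le hs _ _).trans ?_))
    gcongr
    exact hb τ hτ
  have hgint : ∀ᶠ N in atTop, IntervalIntegrable (g N) volume 0 t := by
    filter_upwards [hgw] with N hN
    have hmeas : StronglyMeasurable (g N) := by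
      -- The derivative depends on time only through the step index, so strong measurability follows
      -- by factoring through `ℕ`, although the target space need not be separable.
      have h1 : StronglyMeasurable fun k : ℕ => flat (discretize N (s (eulerStep s μ₀ N k))) :=
        StronglyMeasurable.of_discrete
      exact h1.comp_measurable (Nat.measurable_floor.comp (measurable_id.mul_const _))
    refine (hwint.norm.add (intervalIntegrable_const
      (c := ε N + L * (A * (d N + ε N))))).mono_fun' hmeas.aestronglyMeasurable ?_
    refine (ae_restrict_iff' measurableSet_uIoc).2 (ae_of_all _ fun τ hτ => ?_)
    have h1 := hN τ (hsub (uIoc_subset_uIcc hτ))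
    have h2 := norm_le_norm_add_norm_sub' (g N τ) (flat (s (μ τ)))
    simp only
    linarith
  have hint : Tendsto (fun N => ∫ τ in 0..t, g N τ) atTop
      (𝓝 (∫ τ in 0..t, flat (s (μ τ)))) := by
    rw [tendsto_iff_dist_tendsto_zero]
    have hlim : Tendsto (fun N => (ε N + L * (A * (d N + ε N))) * |t - 0|) atTop (𝓝 0) := by
      simpa using (hε.add (he.const_mul (L : ℝ))).mul_const |t - 0|
    refine squeeze_zero' (Eventually.of_forall fun N => dist_nonneg) ?_ hlim
    filter_upwards [hgw, hgint] with N h1 h2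
    rw [dist_eq_norm, ← intervalIntegral.integral_sub h2 hwint]
    exact intervalIntegral.norm_integral_le_of_norm_le_const fun τ hτ =>
      h1 τ (hsub (uIoc_subset_uIcc hτ))
  have hstart : Tendsto (fun N => flat (discretize N μ₀)) atTop (𝓝 (flat μ₀)) := by
    rw [tendsto_iff_dist_tendsto_zero]
    exact squeeze_zero' (Eventually.of_forall fun N => dist_nonneg) hdev hd
  refine tendsto_nhds_unique (hμ t ht) ((hstart.add hint).congr' ?_)
  filter_upwards [eventually_gt_atTop 0, hgint] with N hN h2
  have h3 := intervalIntegral.integral_eq_sub_of_hasDeriv_right_of_le ht.1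
    (continuousOn_flat_latticeSolution s μ₀ hN t)
    (fun τ hτ => (hasDerivWithinAt_flat_latticeSolution s μ₀ hN hτ.1.le).mono Ioi_subset_Ici_self)
    h2
  rw [h3, flat_latticeSolution s μ₀ hN le_rfl]
  simp [eulerStep]

/-! ### Weak solutions and the integral equation in the Banach space. -/

theorem exists_testFun_smul_of_contDiff {f : E n → ℝ} (hf : ContDiff ℝ ∞ f)
    (hc : HasCompactSupport f) : ∃ (c : ℝ) (g : TestFun n), ∀ x, f x = c * g x := by
  obtain ⟨K, hK⟩ := hf.lipschitzWith_of_hasCompactSupport hc (by simp)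
  obtain ⟨C, hC⟩ := hc.exists_bound_of_continuous hf.continuous
  exact exists_testFun_smul hK hC

/-- Integration against a smooth compactly supported function is a multiple of evaluation at a test
function, a continuous linear map, so the norm derivative passes to the weak formulation at every
time. -/
theorem isSolution_of_flat_eq_integral {s : M n → M n} {L : ℝ≥0}
    (hs : ∀ μ ν : M n, Wg (s μ) (s ν) ≤ L * Wg μ ν) {T : ℝ} (hT : 0 ≤ T) {μ₀ : M n}
    {μ : ℝ → M n} (hcont : ContinuousOn (fun t => flat (μ t)) (Icc 0 T))
    (h : ∀ t ∈ Icc 0 T, flat (μ t) = flat μ₀ + ∫ τ in 0..t, flat (s (μ τ))) :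
    IsSolution s T μ₀ μ := by
  have hw := continuousOn_flat_source hs hcont
  have hint : ∀ {f : E n → ℝ} {c : ℝ} {g : TestFun n}, (∀ x, f x = c * g x) → ∀ ρ : M n,
      ∫ x, f x ∂ρ.toMeasure = c * BoundedContinuousFunction.evalCLM ℝ g (flat ρ) := by
    intro f c g hfg ρ
    simp only [hfg, integral_const_mul]
    rfl
  have hderiv : ∀ {f : E n → ℝ} {c : ℝ} {g : TestFun n}, (∀ x, f x = c * g x) →
      ∀ t ∈ Icc 0 T, HasDerivWithinAt (fun τ => ∫ x, f x ∂(μ τ).toMeasure)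
        (∫ x, f x ∂(s (μ t)).toMeasure) (Icc 0 T) t := by
    intro f c g hfg t ht
    simp only [hint hfg]
    exact ((BoundedContinuousFunction.evalCLM ℝ g).hasFDerivAt.comp_hasDerivWithinAt t
      (hasDerivWithinAt_of_eq_integral hT hw h ht)).const_mul c
  have hfcont : ∀ {f : E n → ℝ} {c : ℝ} {g : TestFun n}, (∀ x, f x = c * g x) →
      ContinuousOn (fun τ => ∫ x, f x ∂(s (μ τ)).toMeasure) (Icc 0 T) := by
    intro f c g hfg
    simp only [hint hfg]
    exact continuousOn_const.mul
      ((BoundedContinuousFunction.evalCLM ℝ g).continuous.comp_continuousOn hw)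
  refine ⟨flat_injective ?_, fun t ht => ?_, fun f hf hc => ?_, fun f hf hc => ?_,
    fun f hf hc => ?_⟩
  · simpa using h 0 ⟨le_rfl, hT⟩
  · simp only [← edist_flat]
    exact tendsto_iff_edist_tendsto_0.1 (hcont t ht)
  · obtain ⟨c, g, hfg⟩ := exists_testFun_smul_of_contDiff hf hc
    exact (hfcont hfg).integrableOn_Icc
  · obtain ⟨c, g, hfg⟩ := exists_testFun_smul_of_contDiff hf hc
    obtain ⟨C, hC⟩ := isCompact_Icc.exists_bound_of_continuousOn (hfcont hfg)
    refine LipschitzOnWith.absolutelyContinuousOnInterval (K := C.toNNReal) ?_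
    rw [uIcc_of_le hT]
    refine (convex_Icc 0 T).lipschitzOnWith_of_nnnorm_hasDerivWithin_le (hderiv hfg)
      fun t ht => ?_
    rw [← norm_toNNReal]
    exact Real.toNNReal_le_toNNReal (hC t ht)
  · obtain ⟨c, g, hfg⟩ := exists_testFun_smul_of_contDiff hf hc
    exact (ae_restrict_iff' measurableSet_Icc).2 (ae_of_all _ fun t ht => hderiv hfg t ht)

theorem IsSolution.continuousOn_flat {s : M n → M n} {T : ℝ} {μ₀ : M n} {μ : ℝ → M n}
    (h : IsSolution s T μ₀ μ) : ContinuousOn (fun t => flat (μ t)) (Icc 0 T) := by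
  intro t ht
  have := h.continuous t ht
  simp only [← edist_flat] at this
  exact tendsto_iff_edist_tendsto_0.2 this

theorem IsSolution.integral_eq {s : M n → M n} {T : ℝ} {μ₀ : M n} {μ : ℝ → M n}
    (h : IsSolution s T μ₀ μ) {f : E n → ℝ} (hf : ContDiff ℝ ∞ f) (hc : HasCompactSupport f)
    {t : ℝ} (ht : t ∈ Icc 0 T) : ∫ x, f x ∂(μ t).toMeasure =
      ∫ x, f x ∂μ₀.toMeasure + ∫ τ in 0..t, ∫ x, f x ∂(s (μ τ)).toMeasure := by
  have hT : 0 ≤ T := ht.1.trans ht.2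
  have hac : AbsolutelyContinuousOnInterval (fun t => ∫ x, f x ∂(μ t).toMeasure) 0 t :=
    (h.absolutelyContinuous f hf hc).mono (by
      rw [uIcc_of_le ht.1, uIcc_of_le hT]; exact Icc_subset_Icc_right ht.2)
  have h1 := hac.integral_deriv_eq_sub
  have h2 : ∫ τ in 0..t, deriv (fun t => ∫ x, f x ∂(μ t).toMeasure) τ =
      ∫ τ in 0..t, ∫ x, f x ∂(s (μ τ)).toMeasure := by
    refine intervalIntegral.integral_congr_ae ?_
    have hd := (ae_restrict_iff' measurableSet_Icc).1 (h.hasDeriv f hf hc)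
    -- The derivative within `Icc 0 T` is an ordinary derivative only at interior points.
    have hne : ∀ᵐ τ : ℝ, τ ≠ T := compl_mem_ae_iff.2 (measure_singleton T)
    filter_upwards [hd, hne] with τ h1 h2 h3
    rw [uIoc_of_le ht.1] at h3
    have hτ : τ ≤ T := h3.2.trans ht.2
    exact ((h1 ⟨h3.1.le, hτ⟩).hasDerivAt (Icc_mem_nhds h3.1 (hτ.lt_of_ne h2))).deriv
  rw [h2, h.initial] at h1
  linarith

/-- A bump function supported off the ball integrates to zero against `μ₀` and every source, hence
against `μ t`. This common ball is what allows compactly supported functions to approximate all test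
functions. -/
theorem IsSolution.compl_closedBall {s : M n → M n} {T : ℝ} {μ₀ : M n} {μ : ℝ → M n}
    (h : IsSolution s T μ₀ μ) {R : ℝ} (hsR : ∀ μ, (s μ).toMeasure (Metric.closedBall 0 R)ᶜ = 0)
    (hμ₀ : μ₀.toMeasure (Metric.closedBall 0 R)ᶜ = 0) {t : ℝ} (ht : t ∈ Icc 0 T) :
    (μ t).toMeasure (Metric.closedBall 0 R)ᶜ = 0 := by
  have hsupp : (μ t).toMeasure.support ⊆ Metric.closedBall 0 R := by
    intro x hx
    by_contra hxR
    obtain ⟨f, hfs, hfc, hf, hfr, hfx⟩ := exists_contDiff_tsupport_subset (n := ⊤)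
      ((Metric.isClosed_closedBall (x := (0 : E n)) (ε := R)).isOpen_compl.mem_nhds hxR)
    have hzero : ∀ ρ : M n, ρ.toMeasure (Metric.closedBall 0 R)ᶜ = 0 →
        ∫ y, f y ∂ρ.toMeasure = 0 := by
      intro ρ hρ
      refine integral_eq_zero_of_ae ?_
      filter_upwards [show ∀ᵐ y ∂ρ.toMeasure, y ∈ Metric.closedBall 0 R from mem_ae_iff.2 hρ]
        with y hy
      exact image_eq_zero_of_notMem_tsupport fun hy' => hfs hy' hy
    have h1 := h.integral_eq hf hfc ht
    simp only [hzero _ (hsR _), hzero _ hμ₀, intervalIntegral.integral_zero, add_zero] at h1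
    have h2 := (integral_eq_zero_iff_of_nonneg (fun y => (hfr (mem_range_self y)).1)
      (hf.continuous.integrable_of_hasCompactSupport hfc)).1 h1
    have h3 : Function.support f ∈ 𝓝 x :=
      hf.continuous.isOpen_support.mem_nhds (by rw [Function.mem_support, hfx]; exact one_ne_zero)
    exact ((Measure.mem_support_iff_forall x).1 hx _ h3).ne' (ae_iff.1 h2)
  exact measure_mono_null (compl_subset_compl.2 hsupp) Measure.measure_compl_support

theorem TestFun.exists_contDiff_approx (f : TestFun n) (R : ℝ) {δ : ℝ} (hδ : 0 < δ) :
    ∃ g : E n → ℝ, ContDiff ℝ ∞ g ∧ HasCompactSupport g ∧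
      ∀ x ∈ Metric.closedBall 0 R, |f x - g x| ≤ δ := by
  obtain ⟨g, hg, hfg⟩ := f.lipschitz.uniformContinuous.exists_contDiff_dist_le hδ
  -- The cutoff equals `1` on the ball; the absolute value keeps the radii positive for every `R`.
  let χ : ContDiffBump (0 : E n) := ⟨|R| + 1, |R| + 2, by positivity, by linarith⟩
  refine ⟨fun x => χ x * g x, χ.contDiff.mul hg, χ.hasCompactSupport.mul_right, fun x hx => ?_⟩
  have hx' : x ∈ Metric.closedBall (0 : E n) χ.rIn :=
    Metric.closedBall_subset_closedBall ((le_abs_self R).trans (by simp [χ])) hx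
  beta_reduce
  rw [χ.one_of_mem_closedBall hx', one_mul, ← Real.dist_eq, dist_comm]
  exact (hfg x).le

theorem abs_integral_sub_integral_le {ρ : M n} {R : ℝ}
    (hρ : ρ.toMeasure (Metric.closedBall 0 R)ᶜ = 0) (f : TestFun n) {g : E n → ℝ}
    (hg : Continuous g) (hgc : HasCompactSupport g) {δ : ℝ}
    (hfg : ∀ x ∈ Metric.closedBall 0 R, |f x - g x| ≤ δ) :
    |∫ x, f x ∂ρ.toMeasure - ∫ x, g x ∂ρ.toMeasure| ≤ δ * ‖flat ρ‖ := by
  rw [← integral_sub (f.integrable _) (hg.integrable_of_hasCompactSupport hgc), norm_flat,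
    ← Real.norm_eq_abs]
  refine norm_integral_le_of_norm_le_const ?_
  filter_upwards [show ∀ᵐ y ∂ρ.toMeasure, y ∈ Metric.closedBall 0 R from mem_ae_iff.2 hρ]
    with y hy
  exact hfg y hy

/-- The identity is checked at each test function `f`. All measures involved live in one ball, where
`f` is a uniform limit of smooth compactly supported functions, for which the weak equation holds.
-/
theorem IsSolution.flat_eq_integral {s : M n → M n} {L : ℝ≥0}
    (hs : ∀ μ ν : M n, Wg (s μ) (s ν) ≤ L * Wg μ ν) {T : ℝ} {μ₀ : M n} {μ : ℝ → M n}
    (h : IsSolution s T μ₀ μ) {R : ℝ} (hsR : ∀ μ, (s μ).toMeasure (Metric.closedBall 0 R)ᶜ = 0)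
    (hμ₀ : μ₀.toMeasure (Metric.closedBall 0 R)ᶜ = 0) {t : ℝ} (ht : t ∈ Icc 0 T) :
    flat (μ t) = flat μ₀ + ∫ τ in 0..t, flat (s (μ τ)) := by
  have hw := continuousOn_flat_source hs h.continuousOn_flat
  have hsub : uIcc 0 t ⊆ Icc 0 T := by
    rw [uIcc_of_le ht.1]; exact Icc_subset_Icc_right ht.2
  have hwint : IntervalIntegrable (fun τ => flat (s (μ τ))) volume 0 t :=
    (hw.mono hsub).intervalIntegrable
  obtain ⟨B, hB⟩ := isCompact_Icc.exists_bound_of_continuousOn hw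
  have hB0 : 0 ≤ B := (norm_nonneg _).trans (hB t ht)
  ext f
  have hcomm := (BoundedContinuousFunction.evalCLM ℝ f).intervalIntegral_comp_comm hwint
  change _ = flat μ₀ f + BoundedContinuousFunction.evalCLM ℝ f (∫ τ in 0..t, flat (s (μ τ)))
  rw [← hcomm]
  change ∫ x, f x ∂(μ t).toMeasure = ∫ x, f x ∂μ₀.toMeasure +
    ∫ τ in 0..t, ∫ x, f x ∂(s (μ τ)).toMeasure
  have hfint : IntervalIntegrable (fun τ => ∫ x, f x ∂(s (μ τ)).toMeasure) volume 0 t :=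
    ((BoundedContinuousFunction.evalCLM ℝ f).continuous.comp_continuousOn
      (hw.mono hsub)).intervalIntegrable
  rw [← sub_eq_zero, ← abs_eq_zero]
  refine le_antisymm (le_of_forall_pos_le_add fun r hr => ?_) (abs_nonneg _)
  -- The total mass against which the approximation error is integrated; the `1` ensures positivity.
  set C := ‖flat (μ t)‖ + ‖flat μ₀‖ + B * |t - 0| + 1
  have hC : 0 < C := by positivity
  obtain ⟨g, hg, hgc, hfg⟩ := f.exists_contDiff_approx R (div_pos hr hC)
  have hgint : IntervalIntegrable (fun τ => ∫ x, g x ∂(s (μ τ)).toMeasure) volume 0 t := by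
    rw [intervalIntegrable_iff_integrableOn_Icc_of_le ht.1]
    exact (h.integrable g hg hgc).mono_set (Icc_subset_Icc_right ht.2)
  have e0 := h.integral_eq hg hgc ht
  have e1 := abs_integral_sub_integral_le (h.compl_closedBall hsR hμ₀ ht) f hg.continuous hgc hfg
  have e2 := abs_integral_sub_integral_le hμ₀ f hg.continuous hgc hfg
  have e3 : |(∫ τ in 0..t, ∫ x, f x ∂(s (μ τ)).toMeasure) -
      ∫ τ in 0..t, ∫ x, g x ∂(s (μ τ)).toMeasure| ≤ r / C * B * |t - 0| := by
    rw [← intervalIntegral.integral_sub hfint hgint, ← Real.norm_eq_abs]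
    refine intervalIntegral.norm_integral_le_of_norm_le_const fun τ hτ => ?_
    refine (abs_integral_sub_integral_le (hsR (μ τ)) f hg.continuous hgc hfg).trans ?_
    gcongr
    exact hB τ (hsub (uIoc_subset_uIcc hτ))
  have e4 : r / C * ‖flat (μ t)‖ + r / C * ‖flat μ₀‖ + r / C * B * |t - 0| ≤ r := by
    have : r / C * ‖flat (μ t)‖ + r / C * ‖flat μ₀‖ + r / C * B * |t - 0| = r / C * (C - 1) := by
      simp only [C]; ring
    rw [this, mul_sub, div_mul_cancel₀ _ hC.ne']
    have : 0 < r / C := div_pos hr hC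
    linarith
  rw [zero_add]
  rw [abs_le] at e1 e2 e3 ⊢
  constructor <;> linarith [e1.1, e1.2, e2.1, e2.2, e3.1, e3.2]

/-! ### Stability and the main theorem. -/

/-- Solutions are exact trajectories of the Lipschitz field, so Grönwall's inequality applies with
zero drift error. The auxiliary ball depends on the initial datum, but the constant does not. -/
theorem IsSolution.dist_flat_le {s : M n → M n} {L : ℝ≥0}
    (hs : ∀ μ ν : M n, Wg (s μ) (s ν) ≤ L * Wg μ ν) {R : ℝ}
    (hsR : ∀ μ, (s μ).toMeasure (Metric.closedBall 0 R)ᶜ = 0) {T : ℝ} {μ₀ ν₀ : M n}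
    {μ ν : ℝ → M n} (hμ : IsSolution s T μ₀ μ) (hν : IsSolution s T ν₀ ν) {t : ℝ}
    (ht : t ∈ Icc 0 T) :
    dist (flat (μ t)) (flat (ν t)) ≤ dist (flat μ₀) (flat ν₀) * Real.exp (L * t) := by
  have hT : 0 ≤ T := ht.1.trans ht.2
  have hderiv : ∀ {μ₀ : M n} {μ : ℝ → M n}, IsSolution s T μ₀ μ → ∀ t ∈ Ico 0 T,
      HasDerivWithinAt (fun t => flat (μ t)) (flat (s (μ t))) (Ici t) t := by
    intro μ₀ μ hμ t ht
    obtain ⟨R', hR'⟩ := μ₀.exists_measure_compl_closedBall_eq_zero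
    have hd := hasDerivWithinAt_of_eq_integral hT
      (continuousOn_flat_source hs hμ.continuousOn_flat)
      (fun t ht => hμ.flat_eq_integral hs (R := max R R')
        (fun ρ => measure_mono_null (compl_subset_compl.2
          (Metric.closedBall_subset_closedBall (le_max_left _ _))) (hsR ρ))
        (measure_mono_null (compl_subset_compl.2
          (Metric.closedBall_subset_closedBall (le_max_right _ _))) hR') ht)
      (Ico_subset_Icc_self ht)
    exact hd.mono_of_mem_nhdsWithin (Icc_mem_nhdsGE_of_mem ht)
  have h := dist_le_of_approx_trajectories_ODE_of_mem (v := fun _ => sourceField s) (K := L)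
    (s := fun _ => range flat) (εf := 0) (εg := 0) (δ := dist (flat μ₀) (flat ν₀))
    (fun t _ => lipschitzOnWith_sourceField hs) hμ.continuousOn_flat (hderiv hμ)
    (fun t _ => by rw [sourceField_flat, dist_self]) (fun t _ => mem_range_self _)
    hν.continuousOn_flat (hderiv hν)
    (fun t _ => by rw [sourceField_flat, dist_self]) (fun t _ => mem_range_self _)
    (by rw [hμ.initial, hν.initial]) t ht
  rwa [add_zero, gronwallBound_ε0, sub_zero] at h

theorem ofReal_dist_flat (μ ν : M n) : ENNReal.ofReal (dist (flat μ) (flat ν)) = Wg μ ν := by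
  rw [← edist_dist, edist_flat]

end MeasureSource

end

open MeasureSource in
theorem mainTheorem3 (n : ℕ) (T : ℝ) (hT : 0 < T) (s : M n → M n) (L : ℝ≥0)
    (hs1 : ∀ μ ν : M n, Wg (s μ) (s ν) ≤ L * Wg μ ν)
    (hs2 : ∃ R : ℝ, ∀ μ : M n, (s μ).toMeasure.support ⊆ Metric.ball 0 R) :
    (∀ μ₀ : M n, ∃ μ : ℝ → M n, IsSolution s T μ₀ μ ∧
      (∀ ν : ℝ → M n, IsSolution s T μ₀ ν → ∀ t ∈ Icc 0 T, ν t = μ t) ∧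
      Tendsto (fun N : ℕ => ⨆ t ∈ Icc 0 T, Wg (latticeSolution s μ₀ N t) (μ t)) atTop (𝓝 0)) ∧
    (∀ (μ₀ ν₀ : M n) (μ ν : ℝ → M n), IsSolution s T μ₀ μ → IsSolution s T ν₀ ν →
      ∀ t ∈ Icc 0 T, Wg (μ t) (ν t) ≤ ENNReal.ofReal (Real.exp (L * t)) * Wg μ₀ ν₀) := by
  obtain ⟨R, hR⟩ := hs2
  have hsR : ∀ μ, (s μ).toMeasure (Metric.closedBall 0 R)ᶜ = 0 := fun μ =>
    measure_mono_null (compl_subset_compl.2 ((hR μ).trans Metric.ball_subset_closedBall))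
      Measure.measure_compl_support
  have hstab : ∀ (μ₀ ν₀ : M n) (μ ν : ℝ → M n), IsSolution s T μ₀ μ → IsSolution s T ν₀ ν →
      ∀ t ∈ Icc 0 T, Wg (μ t) (ν t) ≤ ENNReal.ofReal (Real.exp (L * t)) * Wg μ₀ ν₀ := by
    intro μ₀ ν₀ μ ν hμ hν t ht
    rw [← ofReal_dist_flat, ← ofReal_dist_flat, ← ENNReal.ofReal_mul (Real.exp_pos _).le, mul_comm]
    exact ENNReal.ofReal_le_ofReal (hμ.dist_flat_le hs1 hsR hν ht)
  refine ⟨fun μ₀ => ?_, hstab⟩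
  obtain ⟨R', hR'⟩ := μ₀.exists_measure_compl_closedBall_eq_zero
  obtain ⟨μ, e, he, hbound, hcont, heq⟩ := exists_limit_latticeSolution hs1 (R := max R R')
    (fun ρ => measure_mono_null (compl_subset_compl.2
      (Metric.closedBall_subset_closedBall (le_max_left _ _))) (hsR ρ)) μ₀
    (measure_mono_null (compl_subset_compl.2
      (Metric.closedBall_subset_closedBall (le_max_right _ _))) hR') hT.le
  have hsol := isSolution_of_flat_eq_integral hs1 hT.le hcont heq
  refine ⟨μ, hsol, fun ν hν t ht => flat_injective ?_, ?_⟩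
  · have h := hν.dist_flat_le hs1 hsR hsol ht
    rw [dist_self, zero_mul] at h
    exact dist_le_zero.1 h
  · refine tendsto_of_tendsto_of_tendsto_of_le_of_le' tendsto_const_nhds
      (by simpa using ENNReal.tendsto_ofReal he) (Eventually.of_forall fun N => zero_le) ?_
    filter_upwards [hbound] with N hN
    refine iSup₂_le fun t ht => ?_
    rw [← ofReal_dist_flat]
    exact ENNReal.ofReal_le_ofReal (hN t ht)
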